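/- Fix an integer $k\ge 2$ and $\alpha\in\mathbb{C}$ with $|\alpha|<2$. For an integer $N\ge 2$ let $\mathfrak X_N^{(k)}$ be the finite set of all $k$-free positive integers whose prime factors do not exceed $N$, i.e. of all products $\prod_{p\le N}p^{\nu(p)}$ over primes with $0\le\nu(p)\le k-1$. Let $\Omega(x)$ be the number of prime factors of $x$ counted with multiplicity, put $Z_N=\sum_{x\in\mathfrak X_N^{(k)}}\alpha^{\Omega(x)}/x$, and $$\varphi_N(\lambda)=\frac1{Z_N}\sum_{x\in\mathfrak X_N^{(k)}}\frac{\alpha^{\Omega(x)}}{x}\,e^{i\lambda\frac{\log x}{\log N}},\qquad \varphi^{(\alpha)}(\lambda)=\exp\left\{\alpha\int_0^1\frac{e^{i\lambda v}-1}{v}\,dv\right\}\qquad(\lambda\in\mathbb{R}).$$ Let $\hat f$ denote the Fourier transform of $f$, in the sense of tempered distributions and normalized by $\hat f(\lambda)=\frac1{2\pi}\int_{\mathbb R} f(x)e^{-i\lambda x}\,dx$ for integrable $f$. For real $\eta$ let $\mathcal S_\eta(\mathbb{R})$ be the set of functions $f:\mathbb{R}\to\mathbb{C}$ whose Fourier transform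 is (represented by) a function for which there is $C>0$ with $|\hat f(\lambda)|\le C/(1+|\lambda|^\eta)$ for all $\lambda\in\mathbb{R}$. Proposition. Let $f\in\mathcal S_\eta(\mathbb{R})$ with $\eta\ge|\alpha|-\Re\alpha+1$. Then for every $R=R(N)$, positive for all large $N$, such that $$\frac{R}{\log N}\to0\quad\text{and}\quad\frac{(\log N)^{|\alpha|-\Re\alpha}}{R^{\eta-1}}\to0\quad\text{as }N\to\infty,$$ the integrals below converge absolutely and $$\int_{\mathbb{R}}\varphi_N(\lambda)\hat f(\lambda)\,d\lambda=\int_{|\lambda|\le R}\varphi^{(\alpha)}(\lambda)\hat f(\lambda)\,d\lambda+\varepsilon_N\qquad(N\ge2),$$ where $\varepsilon_N\to0$ as $N\to\infty$ and $$\varepsilon_N=O\!\left(\frac{\log\log N}{\log N}\right)+O\!\left(\frac{(\log N)^{|\alpha|-\Re\alpha}}{R^{\eta-1}}\right)\quad\text{as }N\to\infty.$$ The constants implied by the $O$-notation may depend on $k$, $\alpha$, $f$ and $R$. -/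

import Mathlib

open MeasureTheory Filter Topology Asymptotics
open scoped SchwartzMap

namespace SmoothSums

noncomputable section

/-- The set of all `k`-free integers whose prime factors do not exceed `N`, i.e. of all products
`∏_{p ≤ N} p ^ ν(p)` over the primes `p ≤ N` with exponents `0 ≤ ν(p) ≤ k - 1`. -/
def ensemble (k N : ℕ) : Finset ℕ :=
  (Fintype.piFinset fun _ : Nat.primesLE N => Finset.range k).image
    fun ν => ∏ p : Nat.primesLE N, (p : ℕ) ^ ν p

/-- The complex measure `X ↦ ∑_{x ∈ X} α ^ Ω(x) / x`. -/
def P (α : ℂ) (X : Finset ℕ) : ℂ :=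
  ∑ x ∈ X, α ^ ArithmeticFunction.cardFactors x / (x : ℂ)

/-- The partition function. -/
def Z (k : ℕ) (α : ℂ) (N : ℕ) : ℂ :=
  P α (ensemble k N)

/-- The normalized complex measure on `ensemble k N`. -/
def PN (k : ℕ) (α : ℂ) (N : ℕ) (X : Finset ℕ) : ℂ :=
  (Z k α N)⁻¹ * P α X

/-- The function `ξ_N(x) = log x / log N`. -/
def xi (N x : ℕ) : ℝ :=
  Real.log x / Real.log N

/-- The characteristic function `φ_N(l)` of `ξ_N` with respect to the normalized measure. -/
def phiN (k : ℕ) (α : ℂ) (N : ℕ) (l : ℝ) : ℂ :=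
  ∑ x ∈ ensemble k N, Complex.exp (Complex.I * l * xi N x) * PN k α N {x}

/-- The limiting characteristic function `exp (α ∫₀¹ (e ^ (i l v) - 1) / v dv)`. -/
def phi (α : ℂ) (l : ℝ) : ℂ :=
  Complex.exp (α * ∫ v in (0 : ℝ)..1, (Complex.exp (Complex.I * l * v) - 1) / v)

/-- The Fourier transform of an integrable function, normalized so that the inversion formula
reads `f(x) = ∫ f̂(l) e ^ (i l x) dl`. -/
def fourierTransform (f : ℝ → ℂ) (l : ℝ) : ℂ :=
  (1 / (2 * Real.pi) : ℝ) * ∫ x : ℝ, f x * Complex.exp (-(Complex.I * l * x))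

/-- `g` is the Fourier transform of `f`, both being tempered functions: `∫ g ψ = ∫ f ψ̂` for all
Schwartz functions `ψ`. This covers the integrable functions `f`
(see `hasFourierTransform_of_integrable`), and `g` is determined by `f` up to a null set
(see `HasFourierTransform.ae_eq`). -/
structure HasFourierTransform (f g : ℝ → ℂ) : Prop where
  integrable_left : ∀ ψ : 𝓢(ℝ, ℂ), Integrable fun x => f x * ψ x
  integrable_right : ∀ ψ : 𝓢(ℝ, ℂ), Integrable fun l => g l * ψ l
  integral_eq : ∀ ψ : 𝓢(ℝ, ℂ), ∫ l, g l * ψ l = ∫ x, f x * fourierTransform ψ x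

/-- The space of functions whose Fourier transform is at most `C / (1 + |l| ^ η)` for some `C`. -/
def S (η : ℝ) : Set (ℝ → ℂ) :=
  {f | ∃ g : ℝ → ℂ, HasFourierTransform f g ∧
    ∃ C : ℝ, 0 < C ∧ ∀ l : ℝ, ‖g l‖ ≤ C / (1 + |l| ^ η)}

theorem continuous_fourierTransform {f : ℝ → ℂ} (hf : Integrable f) :
    Continuous (fourierTransform f) := by
  unfold fourierTransform
  refine continuous_const.mul ?_
  refine continuous_of_dominated (bound := fun x => ‖f x‖) ?_ ?_ hf.norm ?_
  · intro l
    exact hf.1.mul (by fun_prop : Continuous fun x : ℝ =>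
      Complex.exp (-(Complex.I * l * x))).aestronglyMeasurable
  · intro l
    refine ae_of_all _ fun x => ?_
    have : -(Complex.I * l * x) = ((-(l * x) : ℝ) : ℂ) * Complex.I := by push_cast; ring
    rw [norm_mul, this, Complex.norm_exp_ofReal_mul_I, mul_one]
  · exact ae_of_all _ fun x => by fun_prop

theorem norm_fourierTransform_le (f : ℝ → ℂ) (l : ℝ) :
    ‖fourierTransform f l‖ ≤ (1 / (2 * Real.pi)) * ∫ x, ‖f x‖ := by
  unfold fourierTransform
  rw [norm_mul, Complex.norm_real, Real.norm_of_nonneg (by positivity)]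
  refine mul_le_mul_of_nonneg_left ?_ (by positivity)
  refine (norm_integral_le_integral_norm _).trans_eq (integral_congr_ae (ae_of_all _ fun x => ?_))
  have : -(Complex.I * l * x) = ((-(l * x) : ℝ) : ℂ) * Complex.I := by push_cast; ring
  simp only [norm_mul, this, Complex.norm_exp_ofReal_mul_I, mul_one]

theorem hasFourierTransform_of_integrable {f : ℝ → ℂ} (hf : Integrable f) :
    HasFourierTransform f (fourierTransform f) where
  integrable_left ψ :=
    hf.mul_bdd (c := SchwartzMap.seminorm ℝ 0 0 ψ) ψ.continuous.aestronglyMeasurable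
      (ae_of_all _ fun x => SchwartzMap.norm_le_seminorm ℝ ψ x)
  integrable_right ψ :=
    ψ.integrable.bdd_mul (continuous_fourierTransform hf).aestronglyMeasurable
      (ae_of_all _ fun x => norm_fourierTransform_le f x)
  integral_eq ψ := by
    have hint : Integrable (Function.uncurry fun l x : ℝ =>
        (ψ l * f x) * Complex.exp (-(Complex.I * l * x))) (volume.prod volume) := by
      refine (ψ.integrable.mul_prod hf).mul_bdd (c := 1) ?_ (ae_of_all _ fun p => ?_)
      · exact (by fun_prop : Continuous fun p : ℝ × ℝ =>
          Complex.exp (-(Complex.I * p.1 * p.2))).aestronglyMeasurable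
      · have : -(Complex.I * p.1 * p.2) = ((-(p.1 * p.2) : ℝ) : ℂ) * Complex.I := by
          push_cast; ring
        rw [this, Complex.norm_exp_ofReal_mul_I]
    have hswap := integral_integral_swap hint
    unfold fourierTransform
    have h1 : ∀ l : ℝ, ((1 / (2 * Real.pi) : ℝ) : ℂ) *
        (∫ x : ℝ, f x * Complex.exp (-(Complex.I * l * x))) * ψ l =
        ((1 / (2 * Real.pi) : ℝ) : ℂ) *
          ∫ x : ℝ, (ψ l * f x) * Complex.exp (-(Complex.I * l * x)) := by
      intro l
      simp_rw [mul_assoc (ψ l)]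
      rw [integral_const_mul]
      ring
    have h2 : ∀ x : ℝ, f x * (((1 / (2 * Real.pi) : ℝ) : ℂ) *
        (∫ l : ℝ, ψ l * Complex.exp (-(Complex.I * x * l)))) =
        ((1 / (2 * Real.pi) : ℝ) : ℂ) *
          ∫ l : ℝ, (ψ l * f x) * Complex.exp (-(Complex.I * l * x)) := by
      intro x
      have : ∀ l : ℝ, (ψ l * f x) * Complex.exp (-(Complex.I * l * x)) =
          f x * (ψ l * Complex.exp (-(Complex.I * x * l))) := by
        intro l
        rw [show Complex.I * (l : ℂ) * x = Complex.I * x * l by ring]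
        ring
      simp_rw [this]
      rw [integral_const_mul]
      ring
    simp_rw [h1, h2]
    rw [integral_const_mul, integral_const_mul, hswap]

theorem HasFourierTransform.locallyIntegrable {f g : ℝ → ℂ}
    (h : HasFourierTransform f g) : LocallyIntegrable g := by
  intro x
  let b : ContDiffBump x := ⟨1, 2, one_pos, one_lt_two⟩
  have hs : HasCompactSupport (Complex.ofRealCLM ∘ b) := b.hasCompactSupport.comp_left rfl
  have hi := h.integrable_right
    (hs.toSchwartzMap (Complex.ofRealCLM.contDiff.comp b.contDiff))
  refine ⟨Metric.closedBall x 1, Metric.closedBall_mem_nhds x one_pos,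
    hi.integrableOn.congr_fun (fun y hy => ?_) Metric.isClosed_closedBall.measurableSet⟩
  simp [b.one_of_mem_closedBall hy]

theorem HasFourierTransform.ae_eq {f g₁ g₂ : ℝ → ℂ} (h₁ : HasFourierTransform f g₁)
    (h₂ : HasFourierTransform f g₂) : g₁ =ᵐ[volume] g₂ := by
  refine ae_eq_of_integral_contDiff_smul_eq h₁.locallyIntegrable h₂.locallyIntegrable
    fun u hu hc => ?_
  have hs : HasCompactSupport (Complex.ofRealCLM ∘ u) := hc.comp_left rfl
  have := (h₁.integral_eq (hs.toSchwartzMap (Complex.ofRealCLM.contDiff.comp hu))).trans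
    (h₂.integral_eq (hs.toSchwartzMap (Complex.ofRealCLM.contDiff.comp hu))).symm
  simpa [mul_comm] using this

end

end SmoothSums

/-!
The sum defining `phiN` factors into an Euler product, and `‖α‖ < 2` keeps every factor away from
zero, so `phiN` is the exponential of `α ∑_{p ≤ N} (p ^ (i l / log N) - 1) / p` plus a remainder
that converges absolutely and is `O(|l| / log N)`. Mertens' estimate `∑_{p ≤ x} log p / p = log x +
O(1)` and Abel summation in the coordinate `log p / log N` replace the prime sum by
`∫₀¹ (e^{i l v} - 1) / v dv`, with an error `O(|l| (1 + log (1 + |l|)) / log N)`. That integral is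
`-log (1 + |l|) + O(1)`, so `phi` has size `(1 + |l|) ^ (-Re α)`, while
`phiN = O((log N) ^ (|α| - Re α))` uniformly in `l`.

The second bound controls the integral over `|l| > R`. Over `|l| ≤ R` the difference `phiN - phi` is
`O((1 + |l|) ^ (1 - Re α + 2 τ) / log N)` for every `τ > 0`: powers of `1 + |l|` absorb the
logarithm and the exponential of the error in the exponent. Since `R = O(log N)`, any `τ` with
`2 τ ≤ |α|` is affordable, and `τ` can be chosen so that the integrand is not of order `|l|⁻¹`.
Hence the error `1 / log N` is reached without the factor `log log N`.
-/

namespace SmoothSums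

open Set
open Complex (I exp)
open Real (log)
open scoped Interval

/-! ### Mertens' estimate -/

theorem log_factorial_eq_sum_primesLE (n : ℕ) :
    log n.factorial = ∑ p ∈ n.primesLE, n.factorial.factorization p * log p := by
  rw [Real.log_nat_eq_sum_factorization]
  refine Finsupp.sum_of_support_subset _ (fun p hp => ?_) _ fun p _ => by simp
  have hp_prime := Nat.prime_of_mem_primeFactors hp
  exact Nat.mem_primesLE.2
    ⟨hp_prime.dvd_factorial.1 (Nat.dvd_of_mem_primeFactors hp), hp_prime⟩

theorem factorization_factorial_le {p : ℕ} (hp : p.Prime) (n : ℕ) :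
    (n.factorial.factorization p : ℝ) ≤ n / ((p : ℝ) - 1) := by
  have one_lt_p : (1 : ℝ) < p := by exact_mod_cast hp.one_lt
  have legendre : (p - 1) * n.factorial.factorization p ≤ n :=
    (Nat.sub_one_mul_factorization_factorial hp).trans_le (Nat.sub_le _ _)
  have legendre_real : (((p - 1) * n.factorial.factorization p : ℕ) : ℝ) ≤ n := by
    exact_mod_cast legendre
  rw [Nat.cast_mul, Nat.cast_sub hp.one_lt.le, Nat.cast_one] at legendre_real
  rwa [le_div_iff₀' (by linarith)]

theorem div_sub_one_le_factorization_factorial {p : ℕ} (hp : p.Prime) (n : ℕ) :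
    (n : ℝ) / p - 1 ≤ n.factorial.factorization p := by
  have first_term : n / p ≤ n.factorial.factorization p := by
    rw [Nat.factorization_factorial hp (b := Nat.log p n + 2) (by omega)]
    simpa only [pow_one] using Finset.single_le_sum (f := fun i => n / p ^ i)
      (fun i _ => Nat.zero_le _) (Finset.mem_Ico.2 ⟨le_rfl, by omega⟩ :
        1 ∈ Finset.Ico 1 (Nat.log p n + 2))
  have floor_lower : (n : ℝ) / p < (n / p : ℕ) + 1 := by
    rw [← Nat.floor_div_eq_div (K := ℝ)]
    exact Nat.lt_floor_add_one _
  have : ((n / p : ℕ) : ℝ) ≤ n.factorial.factorization p := by exact_mod_cast first_term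
  linarith

theorem log_div_mul_sub_one_nonneg (n : ℕ) : 0 ≤ log n / ((n : ℝ) * (n - 1)) := by
  rcases n.eq_zero_or_pos with rfl | hn
  · simp
  · have : (1 : ℝ) ≤ n := by exact_mod_cast hn
    exact div_nonneg (Real.log_natCast_nonneg n) (mul_nonneg (by positivity) (by linarith))

theorem summable_log_div_mul_sub_one :
    Summable fun n : ℕ => log n / ((n : ℝ) * (n - 1)) := by
  refine .of_nonneg_of_le log_div_mul_sub_one_nonneg (fun n => ?_)
    ((Real.summable_one_div_nat_rpow.2 (by norm_num : (1 : ℝ) < 3 / 2)).mul_left 4)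
  rcases Nat.lt_or_ge n 2 with hn | hn
  · interval_cases n <;> simp [Real.zero_rpow]
  have two_le : (2 : ℝ) ≤ n := by exact_mod_cast hn
  have pos : (0 : ℝ) < n := by linarith
  have log_le : log n ≤ 2 * (n : ℝ) ^ (1 / 2 : ℝ) := by
    linarith [Real.log_le_rpow_div pos.le (one_half_pos (α := ℝ))]
  have rpow_mul_rpow : (n : ℝ) ^ (1 / 2 : ℝ) * (n : ℝ) ^ (3 / 2 : ℝ) = n * n := by
    rw [← Real.rpow_add pos, ← sq, ← Real.rpow_natCast]
    norm_num
  rw [mul_one_div, div_le_div_iff₀ (by nlinarith) (by positivity)]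
  calc log n * (n : ℝ) ^ (3 / 2 : ℝ)
      ≤ 2 * (n : ℝ) ^ (1 / 2 : ℝ) * (n : ℝ) ^ (3 / 2 : ℝ) := by gcongr
    _ = 2 * (n * n) := by rw [mul_assoc, rpow_mul_rpow]
    _ ≤ 4 * (n * (n - 1)) := by nlinarith

/-- The sum `∑_{p ≤ x} (log p) / p` over the primes, which Mertens' estimate compares to `log x`. -/
noncomputable def mertensSum (x : ℝ) : ℝ :=
  ∑ p ∈ ⌊x⌋₊.primesLE, log p / p

theorem mul_mertensSum_le (n : ℕ) :
    n * mertensSum n ≤ log n.factorial + Chebyshev.theta n := by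
  rw [mertensSum, Nat.floor_natCast, log_factorial_eq_sum_primesLE,
    Chebyshev.theta_eq_sum_primesLE_log, Finset.mul_sum, ← Finset.sum_add_distrib]
  refine Finset.sum_le_sum fun p hp => ?_
  have := mul_le_mul_of_nonneg_right (div_sub_one_le_factorization_factorial
    (Nat.prime_of_mem_primesLE hp) n) (Real.log_natCast_nonneg p)
  calc (n : ℝ) * (log p / p) = (n / p - 1) * log p + log p := by ring
    _ ≤ _ := by gcongr

theorem log_factorial_le_mul_mertensSum_add (n : ℕ) :
    log n.factorial ≤ n * (mertensSum n + ∑' m : ℕ, log m / ((m : ℝ) * (m - 1))) := by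
  have sum_le := summable_log_div_mul_sub_one.sum_le_tsum n.primesLE
    fun m _ => log_div_mul_sub_one_nonneg m
  refine le_trans ?_ (mul_le_mul_of_nonneg_left (add_le_add_right sum_le _) n.cast_nonneg)
  rw [log_factorial_eq_sum_primesLE, mertensSum, Nat.floor_natCast,
    ← Finset.sum_add_distrib, Finset.mul_sum]
  refine Finset.sum_le_sum fun p hp => ?_
  have hp_prime := Nat.prime_of_mem_primesLE hp
  have one_lt_p : (1 : ℝ) < p := by exact_mod_cast hp_prime.one_lt
  refine (mul_le_mul_of_nonneg_right (factorization_factorial_le hp_prime n)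
    (Real.log_natCast_nonneg p)).trans_eq ?_
  have : (p : ℝ) - 1 ≠ 0 := by linarith
  field_simp
  ring

theorem exists_abs_mertensSum_natCast_sub_log_le :
    ∃ C : ℝ, ∀ n : ℕ, 1 ≤ n → |mertensSum n - log n| ≤ C := by
  set T := ∑' m : ℕ, log m / ((m : ℝ) * (m - 1))
  have hT_nonneg : 0 ≤ T := tsum_nonneg log_div_mul_sub_one_nonneg
  have log_four_pos : 0 < log 4 := Real.log_pos (by norm_num)
  refine ⟨1 + T + log 4, fun n hn => ?_⟩
  have n_pos : (0 : ℝ) < n := by exact_mod_cast hn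
  have log_factorial_le : log n.factorial ≤ n * log n := by
    rw [← Real.log_pow]
    exact Real.log_le_log (by exact_mod_cast n.factorial_pos) (by exact_mod_cast n.factorial_le_pow)
  have le_log_factorial : n * log n - n ≤ log n.factorial := by
    have stirling := Stirling.le_log_factorial_stirling (n := n) (by omega)
    have : 0 ≤ log (2 * Real.pi) := Real.log_nonneg (by linarith [Real.pi_gt_three])
    linarith [Real.log_natCast_nonneg n]
  have chebyshev := Chebyshev.theta_le_log4_mul_x n_pos.le
  have upper : n * (mertensSum n - log n) ≤ n * log 4 := by
    linarith [mul_mertensSum_le n]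
  have lower : n * (-(1 + T)) ≤ n * (mertensSum n - log n) := by
    linarith [log_factorial_le_mul_mertensSum_add n]
  rw [abs_le]
  constructor
  · linarith [le_of_mul_le_mul_left lower n_pos]
  · linarith [le_of_mul_le_mul_left upper n_pos]

theorem exists_abs_mertensSum_sub_log_le :
    ∃ C : ℝ, 0 ≤ C ∧ ∀ x : ℝ, 1 ≤ x → |mertensSum x - log x| ≤ C := by
  obtain ⟨C, hC⟩ := exists_abs_mertensSum_natCast_sub_log_le
  have hC_nonneg : 0 ≤ C := (abs_nonneg _).trans (hC 1 le_rfl)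
  refine ⟨C + log 2, by positivity, fun x hx => ?_⟩
  have one_le_floor : 1 ≤ ⌊x⌋₊ := (Nat.one_le_floor_iff x).2 hx
  have floor_pos : (0 : ℝ) < ⌊x⌋₊ := by exact_mod_cast one_le_floor
  have log_floor_le : log ⌊x⌋₊ ≤ log x := Real.log_le_log floor_pos (Nat.floor_le (by linarith))
  have log_le : log x ≤ log 2 + log ⌊x⌋₊ := by
    rw [← Real.log_mul (by norm_num) floor_pos.ne']
    refine Real.log_le_log (by linarith) ?_
    have : (1 : ℝ) ≤ ⌊x⌋₊ := by exact_mod_cast one_le_floor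
    linarith [Nat.lt_floor_add_one x]
  have at_floor := hC _ one_le_floor
  rw [mertensSum, Nat.floor_natCast, ← mertensSum, abs_le] at at_floor
  rw [abs_le]
  constructor <;> linarith

/-! ### Abel summation over the primes -/

section AbelSummation

variable {𝕜 : Type*} [RCLike 𝕜] {x : ℝ}

theorem continuousOn_log_Icc_two : ContinuousOn log (Icc 2 x) :=
  Real.continuousOn_log.mono fun _ ht => (two_pos.trans_le ht.1).ne'

theorem sum_primesLE_eq_sum_Icc (a : ℕ → 𝕜) (n : ℕ) :
    ∑ p ∈ n.primesLE, a p = ∑ m ∈ Finset.Icc 0 n, if m.Prime then a m else 0 := by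
  rw [Nat.primesLE_eq_filter_Icc_zero, Finset.sum_filter]

theorem ofReal_mertensSum (x : ℝ) :
    (mertensSum x : 𝕜) =
      ∑ m ∈ Finset.Icc 0 ⌊x⌋₊, if m.Prime then ((log m / m : ℝ) : 𝕜) else 0 := by
  rw [mertensSum, RCLike.ofReal_sum, sum_primesLE_eq_sum_Icc]

theorem integrableOn_mul_mertensSum {g : ℝ → 𝕜} (hg : IntegrableOn g (Icc 2 x)) :
    IntegrableOn (fun t => g t * (mertensSum t : 𝕜)) (Icc 2 x) := by
  simp only [ofReal_mertensSum]
  exact integrableOn_mul_sum_Icc _ zero_le_two hg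

theorem sum_mul_log_div_eq {F F' : ℝ → 𝕜} (hx : 2 ≤ x)
    (hF : ∀ t ∈ Icc 2 x, HasDerivAt F (F' t) t) (hF' : ContinuousOn F' (Icc 2 x)) :
    ∑ p ∈ ⌊x⌋₊.primesLE, F p * ((log p / p : ℝ) : 𝕜) =
      F x * (mertensSum x : 𝕜) - ∫ t in 2..x, F' t * (mertensSum t : 𝕜) := by
  have deriv_eq : EqOn F' (deriv F) (Icc 2 x) := fun t ht => (hF t ht).deriv.symm
  have abel := sum_mul_eq_sub_integral_mul₁
    (fun m : ℕ => if m.Prime then ((log m / m : ℝ) : 𝕜) else 0)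
    (by simp) (by simp) x (fun t ht => (hF t ht).differentiableAt)
    (hF'.integrableOn_Icc.congr_fun deriv_eq measurableSet_Icc)
  simp only [mul_ite, mul_zero, ← ofReal_mertensSum] at abel
  rw [sum_primesLE_eq_sum_Icc (fun p => F p * ((log p / p : ℝ) : 𝕜)), abel,
    intervalIntegral.integral_of_le hx]
  congr 1
  exact setIntegral_congr_fun measurableSet_Ioc fun t ht => by
    simp only [deriv_eq (Ioc_subset_Icc_self ht)]

theorem integral_mul_log_eq {F F' : ℝ → 𝕜} (hx : 2 ≤ x)
    (hF : ∀ t ∈ Icc 2 x, HasDerivAt F (F' t) t) (hF' : ContinuousOn F' (Icc 2 x)) :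
    ∫ t in 2..x, F' t * (log t : 𝕜) =
      F x * (log x : 𝕜) - F 2 * (log 2 : 𝕜) - ∫ t in 2..x, F t * ((t⁻¹ : ℝ) : 𝕜) := by
  have inv_cont : ContinuousOn (fun t : ℝ => ((t⁻¹ : ℝ) : 𝕜)) [[2, x]] := by
    rw [uIcc_of_le hx]
    exact RCLike.continuous_ofReal.comp_continuousOn
      (continuousOn_id.inv₀ fun t ht => (two_pos.trans_le ht.1).ne')
  rw [← uIcc_of_le hx] at hF hF'
  have log_deriv : ∀ t ∈ [[2, x]], HasDerivAt (fun t => (log t : 𝕜)) ((t⁻¹ : ℝ) : 𝕜) t :=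
    fun t ht => (RCLike.ofRealCLM (K := 𝕜)).hasFDerivAt.comp_hasDerivAt t
      (Real.hasDerivAt_log (two_pos.trans_le (uIcc_of_le hx ▸ ht).1).ne')
  have parts := intervalIntegral.integral_mul_deriv_eq_deriv_mul
    hF log_deriv hF'.intervalIntegrable inv_cont.intervalIntegrable
  rw [parts, sub_sub_cancel]

theorem sum_mul_log_div_sub_integral_eq {F F' : ℝ → 𝕜} (hx : 2 ≤ x)
    (hF : ∀ t ∈ Icc 2 x, HasDerivAt F (F' t) t) (hF' : ContinuousOn F' (Icc 2 x)) :
    ∑ p ∈ ⌊x⌋₊.primesLE, F p * ((log p / p : ℝ) : 𝕜) - ∫ t in 2..x, F t * ((t⁻¹ : ℝ) : 𝕜) =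
      F x * ((mertensSum x - log x : ℝ) : 𝕜) + F 2 * (log 2 : 𝕜) -
        ∫ t in 2..x, F' t * ((mertensSum t - log t : ℝ) : 𝕜) := by
  have mertens_int : IntervalIntegrable (fun t => F' t * (mertensSum t : 𝕜)) volume 2 x :=
    (intervalIntegrable_iff_integrableOn_Icc_of_le hx).2
      (integrableOn_mul_mertensSum hF'.integrableOn_Icc)
  have log_int : IntervalIntegrable (fun t => F' t * (log t : 𝕜)) volume 2 x := by
    refine ContinuousOn.intervalIntegrable_of_Icc hx (hF'.mul ?_)
    exact RCLike.continuous_ofReal.comp_continuousOn continuousOn_log_Icc_two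
  simp only [RCLike.ofReal_sub, mul_sub]
  rw [intervalIntegral.integral_sub mertens_int log_int, sum_mul_log_div_eq hx hF hF',
    integral_mul_log_eq hx hF hF']
  ring

theorem exists_norm_sum_mul_log_div_sub_integral_le (𝕜 : Type*) [RCLike 𝕜] :
    ∃ C : ℝ, 0 ≤ C ∧ ∀ (x : ℝ) (F F' : ℝ → 𝕜), 2 ≤ x →
      (∀ t ∈ Icc 2 x, HasDerivAt F (F' t) t) → ContinuousOn F' (Icc 2 x) →
      ‖∑ p ∈ ⌊x⌋₊.primesLE, F p * ((log p / p : ℝ) : 𝕜) - ∫ t in 2..x, F t * ((t⁻¹ : ℝ) : 𝕜)‖ ≤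
        C * (‖F x‖ + ‖F 2‖ + ∫ t in 2..x, ‖F' t‖) := by
  obtain ⟨C, hC_nonneg, hC⟩ := exists_abs_mertensSum_sub_log_le
  refine ⟨C + log 2, by positivity, fun x F F' hx hF hF' => ?_⟩
  have endpoint : ‖F x * ((mertensSum x - log x : ℝ) : 𝕜)‖ ≤ ‖F x‖ * C := by
    rw [norm_mul, RCLike.norm_ofReal]
    gcongr
    exact hC x (by linarith)
  have startpoint : ‖F 2 * (log 2 : 𝕜)‖ = ‖F 2‖ * log 2 := by
    rw [norm_mul, RCLike.norm_ofReal, abs_of_pos (Real.log_pos one_lt_two)]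
  have integral_le : ‖∫ t in 2..x, F' t * ((mertensSum t - log t : ℝ) : 𝕜)‖ ≤
      (∫ t in 2..x, ‖F' t‖) * C := by
    rw [← intervalIntegral.integral_mul_const]
    refine intervalIntegral.norm_integral_le_of_norm_le hx (ae_of_all _ fun t ht => ?_)
      (ContinuousOn.intervalIntegrable_of_Icc hx (hF'.norm.mul continuousOn_const))
    rw [norm_mul, RCLike.norm_ofReal]
    gcongr
    exact hC t (by linarith [ht.1])
  have variation_nonneg : 0 ≤ ∫ t in 2..x, ‖F' t‖ :=
    intervalIntegral.integral_nonneg hx fun _ _ => norm_nonneg _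
  have log_two_pos : 0 < log 2 := Real.log_pos one_lt_two
  rw [sum_mul_log_div_sub_integral_eq hx hF hF']
  calc ‖F x * ((mertensSum x - log x : ℝ) : 𝕜) + F 2 * (log 2 : 𝕜) -
        ∫ t in 2..x, F' t * ((mertensSum t - log t : ℝ) : 𝕜)‖
      ≤ ‖F x‖ * C + ‖F 2‖ * log 2 + (∫ t in 2..x, ‖F' t‖) * C :=
        (norm_sub_le _ _).trans (add_le_add
          ((norm_add_le _ _).trans (add_le_add endpoint startpoint.le)) integral_le)
    _ ≤ (C + log 2) * (‖F x‖ + ‖F 2‖ + ∫ t in 2..x, ‖F' t‖) := by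
        have := mul_nonneg (add_nonneg (norm_nonneg (F x)) variation_nonneg) log_two_pos.le
        have := mul_nonneg (norm_nonneg (F 2)) hC_nonneg
        linarith

theorem integral_inv_smul_comp_log {E : Type*} [NormedAddCommGroup E] [NormedSpace ℝ E]
    {a b : ℝ} (ha : 0 < a) (hab : a ≤ b) {g : ℝ → E}
    (hg : ContinuousOn g (Icc (log a) (log b))) :
    ∫ x in a..b, x⁻¹ • g (log x) = ∫ t in log a..log b, g t := by
  have pos : ∀ x ∈ [[a, b]], 0 < x := fun x hx => ha.trans_le (uIcc_of_le hab ▸ hx).1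
  refine intervalIntegral.integral_deriv_smul_comp' (f := log) (g := g)
    (fun x hx => Real.hasDerivAt_log (pos x hx).ne')
    (continuousOn_id.inv₀ fun x hx => (pos x hx).ne') (hg.mono ?_)
  rintro _ ⟨x, hx, rfl⟩
  rw [uIcc_of_le hab] at hx
  exact ⟨Real.log_le_log ha hx.1, Real.log_le_log (ha.trans_le hx.1) hx.2⟩

theorem exists_norm_sum_comp_log_sub_integral_le (𝕜 : Type*) [RCLike 𝕜] :
    ∃ C : ℝ, 0 ≤ C ∧ ∀ (x : ℝ) (h h' : ℝ → 𝕜), 2 ≤ x →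
      (∀ t ∈ Icc (log 2) (log x), HasDerivAt h (h' t) t) →
      ContinuousOn h' (Icc (log 2) (log x)) →
      ‖∑ p ∈ ⌊x⌋₊.primesLE, h (log p) * ((log p / p : ℝ) : 𝕜) - ∫ t in log 2..log x, h t‖ ≤
        C * (‖h (log x)‖ + ‖h (log 2)‖ + ∫ t in log 2..log x, ‖h' t‖) := by
  obtain ⟨C, hC_nonneg, hC⟩ := exists_norm_sum_mul_log_div_sub_integral_le 𝕜
  refine ⟨C, hC_nonneg, fun x h h' hx hh hh' => ?_⟩
  have log_mem : MapsTo log (Icc 2 x) (Icc (log 2) (log x)) := fun t ht =>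
    ⟨Real.log_le_log two_pos ht.1, Real.log_le_log (two_pos.trans_le ht.1) ht.2⟩
  have inv_cont : ContinuousOn (fun t : ℝ => t⁻¹) (Icc 2 x) :=
    continuousOn_id.inv₀ fun t ht => (two_pos.trans_le ht.1).ne'
  have bound := hC x (fun t => h (log t)) (fun t => t⁻¹ • h' (log t)) hx
    (fun t ht => (hh _ (log_mem ht)).scomp t
      (Real.hasDerivAt_log (two_pos.trans_le ht.1).ne'))
    (inv_cont.smul (hh'.comp continuousOn_log_Icc_two log_mem))
  have integral_eq : ∫ t in 2..x, h (log t) * ((t⁻¹ : ℝ) : 𝕜) = ∫ t in log 2..log x, h t := by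
    rw [← integral_inv_smul_comp_log two_pos hx
      fun t ht => (hh t ht).continuousAt.continuousWithinAt]
    simp only [RCLike.real_smul_eq_coe_mul, mul_comm]
  have variation_eq : ∫ t in 2..x, ‖t⁻¹ • h' (log t)‖ = ∫ t in log 2..log x, ‖h' t‖ := by
    rw [← integral_inv_smul_comp_log two_pos hx hh'.norm]
    refine intervalIntegral.integral_congr fun t ht => ?_
    rw [uIcc_of_le hx] at ht
    simp only [norm_smul, smul_eq_mul, Real.norm_of_nonneg (inv_nonneg.2 (zero_le_two.trans ht.1))]
  rwa [integral_eq, variation_eq] at bound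

end AbelSummation

theorem integral_inv_sq {a b : ℝ} (ha : 0 < a) (hab : a ≤ b) :
    ∫ t in a..b, (t ^ 2)⁻¹ = a⁻¹ - b⁻¹ := by
  have not_mem : (0 : ℝ) ∉ [[a, b]] := by
    rw [uIcc_of_le hab]
    exact fun h => ha.not_ge h.1
  have integral_eq := integral_zpow (n := -2) (Or.inr ⟨by norm_num, not_mem⟩)
  norm_num [div_neg, neg_sub] at integral_eq
  exact integral_eq

theorem exists_sum_primesLE_inv_le :
    ∃ C : ℝ, ∀ N : ℕ, 2 ≤ N → ∑ p ∈ N.primesLE, 1 / (p : ℝ) ≤ log (log N) + C := by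
  obtain ⟨C, hC_nonneg, hC⟩ := exists_norm_sum_comp_log_sub_integral_le ℝ
  refine ⟨C * ((log 2)⁻¹ + (log 2)⁻¹ + (log 2)⁻¹) - log (log 2), fun N hN => ?_⟩
  have two_le : (2 : ℝ) ≤ N := by exact_mod_cast hN
  have log_two_pos : 0 < log 2 := Real.log_pos one_lt_two
  have log_le : log 2 ≤ log N := Real.log_le_log two_pos two_le
  have log_pos : 0 < log N := log_two_pos.trans_le log_le
  have ne_zero : ∀ t ∈ Icc (log 2) (log N), t ≠ 0 := fun t ht => (log_two_pos.trans_le ht.1).ne'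
  have bound := hC N (fun t => t⁻¹) (fun t => -(t ^ 2)⁻¹) two_le
    (fun t ht => hasDerivAt_inv (ne_zero t ht))
    ((continuousOn_id.pow 2).inv₀ fun t ht => pow_ne_zero 2 (ne_zero t ht)).neg
  have sum_eq : ∑ p ∈ N.primesLE, (log p)⁻¹ * (log p / p) = ∑ p ∈ N.primesLE, 1 / (p : ℝ) :=
    Finset.sum_congr rfl fun p hp => by
      have : log p ≠ 0 := (Real.log_pos (by exact_mod_cast (Nat.one_lt_of_mem_primesLE hp))).ne'
      field_simp
  have integral_eq : ∫ t in log 2..log N, t⁻¹ = log (log N) - log (log 2) := by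
    rw [integral_inv_of_pos log_two_pos log_pos, Real.log_div log_pos.ne' log_two_pos.ne']
  have variation_le : ∫ t in log 2..log N, ‖-(t ^ 2)⁻¹‖ ≤ (log 2)⁻¹ := by
    simp only [norm_neg, norm_inv, norm_pow, Real.norm_eq_abs, sq_abs]
    rw [integral_inv_sq log_two_pos log_le]
    linarith [inv_pos.2 log_pos]
  simp only [Nat.floor_natCast, RCLike.ofReal_real_eq_id, id_eq] at bound
  rw [sum_eq, integral_eq] at bound
  have inv_le : ‖(log N)⁻¹‖ ≤ (log 2)⁻¹ := by
    rw [norm_inv, Real.norm_of_nonneg log_pos.le]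
    gcongr
  have inv_eq : ‖(log 2)⁻¹‖ = (log 2)⁻¹ := Real.norm_of_nonneg (by positivity)
  have := (Real.le_norm_self _).trans (bound.trans (mul_le_mul_of_nonneg_left
    (add_le_add (add_le_add inv_le inv_eq.le) variation_le) hC_nonneg))
  linarith

/-! ### The exponent of `phi` -/

theorem norm_exp_I_mul_mul (l v : ℝ) : ‖exp (I * l * v)‖ = 1 := by
  rw [mul_assoc, ← Complex.ofReal_mul, Complex.norm_exp_I_mul_ofReal]

theorem norm_exp_I_mul_mul_sub_one_le (l v : ℝ) : ‖exp (I * l * v) - 1‖ ≤ |l| * |v| := by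
  rw [mul_assoc, ← Complex.ofReal_mul, ← abs_mul]
  exact Real.norm_exp_I_mul_ofReal_sub_one_le

theorem hasDerivAt_exp_I_mul_mul (l t : ℝ) :
    HasDerivAt (fun t : ℝ => exp (I * l * t)) (exp (I * l * t) * (I * l)) t := by
  simpa only [id, mul_one] using
    ((hasDerivAt_id (t : ℂ)).const_mul (I * l)).cexp.comp_ofReal

/-- The integrand `(e ^ (i l v) - 1) / v` in the exponent of `phi`; at `v = 0` it takes the junk
value `0` instead of the limit `i l`. -/
noncomputable def phiKernel (l v : ℝ) : ℂ :=
  (exp (I * l * v) - 1) / v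

/-- The exponent `∫₀¹ (e ^ (i l v) - 1) / v dv` of `phi`, without the factor `α`. -/
noncomputable def phiExponent (l : ℝ) : ℂ :=
  ∫ v in (0 : ℝ)..1, phiKernel l v

theorem phi_eq_exp (α : ℂ) (l : ℝ) : phi α l = exp (α * phiExponent l) := rfl

theorem norm_phiKernel_le (l v : ℝ) : ‖phiKernel l v‖ ≤ |l| := by
  rcases eq_or_ne v 0 with rfl | hv
  · simp [phiKernel]
  · rw [phiKernel, norm_div, Complex.norm_real, Real.norm_eq_abs, div_le_iff₀ (abs_pos.2 hv)]
    exact norm_exp_I_mul_mul_sub_one_le l v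

theorem intervalIntegrable_phiKernel (l a b : ℝ) :
    IntervalIntegrable (phiKernel l) volume a b := by
  have meas : Measurable (phiKernel l) := by
    unfold phiKernel
    fun_prop
  exact intervalIntegrable_iff.2 <| Measure.integrableOn_of_bounded (by simp)
    meas.aestronglyMeasurable (ae_of_all _ (norm_phiKernel_le l))

theorem norm_integral_phiKernel_le (l a : ℝ) : ‖∫ v in 0..a, phiKernel l v‖ ≤ |l| * |a| := by
  simpa only [sub_zero] using intervalIntegral.norm_integral_le_of_norm_le_const
    (a := 0) (b := a) fun v _ => norm_phiKernel_le l v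

theorem mul_phiKernel_mul (L m v : ℝ) : L * phiKernel m (L * v) = phiKernel (m * L) v := by
  rcases eq_or_ne L 0 with rfl | hL
  · simp [phiKernel]
  have hL' : (L : ℂ) ≠ 0 := Complex.ofReal_ne_zero.2 hL
  rw [phiKernel, phiKernel, Complex.ofReal_mul, Complex.ofReal_mul, ← mul_div_assoc,
    mul_div_mul_left _ _ hL']
  ring_nf

theorem integral_phiKernel_zero (m L : ℝ) :
    ∫ t in 0..L, phiKernel m t = phiExponent (m * L) := by
  have scale := intervalIntegral.smul_integral_comp_mul_left (a := 0) (b := 1) (phiKernel m) L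
  rw [mul_zero, mul_one] at scale
  rw [← scale, ← intervalIntegral.integral_smul, phiExponent]
  exact intervalIntegral.integral_congr fun v _ => by
    simp only [Complex.real_smul, mul_phiKernel_mul]

theorem lipschitzWith_phiExponent : LipschitzWith 1 phiExponent := by
  refine .of_dist_le_mul fun l l' => ?_
  have kernel_le (v : ℝ) : ‖phiKernel l v - phiKernel l' v‖ ≤ |l - l'| := by
    have factor : phiKernel l v - phiKernel l' v = exp (I * l' * v) * phiKernel (l - l') v := by
      rw [phiKernel, phiKernel, phiKernel, ← sub_div, ← mul_div_assoc, mul_sub,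
        ← Complex.exp_add, sub_sub_sub_cancel_right, Complex.ofReal_sub]
      ring_nf
    rw [factor, norm_mul, norm_exp_I_mul_mul, one_mul]
    exact norm_phiKernel_le _ v
  rw [dist_eq_norm, phiExponent, phiExponent, ← intervalIntegral.integral_sub
    (intervalIntegrable_phiKernel _ _ _) (intervalIntegrable_phiKernel _ _ _)]
  simpa [Real.dist_eq] using intervalIntegral.norm_integral_le_of_norm_le_const
    (a := 0) (b := 1) fun v _ => kernel_le v

theorem continuous_phi (α : ℂ) : Continuous (phi α) :=
  Complex.continuous_exp.comp (continuous_const.mul lipschitzWith_phiExponent.continuous)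

theorem norm_integral_exp_div_le {l a b : ℝ} (hl : l ≠ 0) (ha : 0 < a) (hab : a ≤ b) :
    ‖∫ t in a..b, exp (I * l * t) / t‖ ≤ 2 / (a * |l|) := by
  have pos : ∀ t ∈ [[a, b]], 0 < t := fun t ht => ha.trans_le (uIcc_of_le hab ▸ ht).1
  have b_pos : 0 < b := ha.trans_le hab
  have Il_ne : I * (l : ℂ) ≠ 0 := mul_ne_zero Complex.I_ne_zero (Complex.ofReal_ne_zero.2 hl)
  have inv_sq_cont : ContinuousOn (fun t : ℝ => (t ^ 2)⁻¹) [[a, b]] :=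
    (continuousOn_pow 2).inv₀ fun t ht => pow_ne_zero 2 (pos t ht).ne'
  have exp_cont : Continuous fun t : ℝ => exp (I * l * t) := by fun_prop
  have parts := intervalIntegral.integral_mul_deriv_eq_deriv_mul
    (u := fun t : ℝ => ((t⁻¹ : ℝ) : ℂ)) (u' := fun t : ℝ => ((-(t ^ 2)⁻¹ : ℝ) : ℂ))
    (v := fun t : ℝ => exp (I * l * t) / (I * l))
    (fun t ht => (hasDerivAt_inv (pos t ht).ne').ofReal_comp)
    (fun t _ => (hasDerivAt_exp_I_mul_mul l t).div_const (I * l))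
    (Complex.continuous_ofReal.comp_continuousOn inv_sq_cont.neg).intervalIntegrable
    (by simpa only [mul_div_cancel_right₀ _ Il_ne] using exp_cont.intervalIntegrable a b)
  have norm_primitive (t : ℝ) : ‖exp (I * l * t) / (I * l)‖ = |l|⁻¹ := by
    simp only [norm_div, norm_exp_I_mul_mul, norm_mul, Complex.norm_I, one_mul,
      Complex.norm_real, Real.norm_eq_abs, one_div]
  have norm_boundary {t : ℝ} (ht : 0 < t) :
      ‖((t⁻¹ : ℝ) : ℂ) * (exp (I * l * t) / (I * l))‖ = t⁻¹ * |l|⁻¹ := by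
    rw [norm_mul, norm_primitive, Complex.norm_real, Real.norm_of_nonneg (inv_nonneg.2 ht.le)]
  have integral_le : ‖∫ t in a..b, ((-(t ^ 2)⁻¹ : ℝ) : ℂ) * (exp (I * l * t) / (I * l))‖ ≤
      (a⁻¹ - b⁻¹) * |l|⁻¹ := by
    rw [← integral_inv_sq ha hab, ← intervalIntegral.integral_mul_const]
    refine intervalIntegral.norm_integral_le_of_norm_le hab (ae_of_all _ fun t _ => ?_)
      (inv_sq_cont.mul continuousOn_const).intervalIntegrable
    rw [norm_mul, norm_primitive, Complex.norm_real, norm_neg, Real.norm_of_nonneg (by positivity)]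
  simp only [mul_div_cancel_right₀ _ Il_ne] at parts
  calc ‖∫ t in a..b, exp (I * l * t) / t‖
      = ‖∫ t in a..b, ((t⁻¹ : ℝ) : ℂ) * exp (I * l * t)‖ := by
        simp only [Complex.ofReal_inv, div_eq_inv_mul]
    _ ≤ b⁻¹ * |l|⁻¹ + a⁻¹ * |l|⁻¹ + (a⁻¹ - b⁻¹) * |l|⁻¹ := by
        rw [parts, ← norm_boundary b_pos, ← norm_boundary ha]
        exact (norm_sub_le _ _).trans (add_le_add (norm_sub_le _ _) integral_le)
    _ = 2 / (a * |l|) := by rw [div_eq_mul_inv, mul_inv]; ring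

theorem norm_integral_exp_div_inv_one_add_abs_le (l : ℝ) :
    ‖∫ v in (1 + |l|)⁻¹..1, exp (I * l * v) / v‖ ≤ 4 := by
  have abs_l_nonneg := abs_nonneg l
  have a_pos : 0 < (1 + |l|)⁻¹ := by positivity
  have a_le_one : (1 + |l|)⁻¹ ≤ 1 := inv_le_one_of_one_le₀ (by linarith)
  rcases le_total |l| 1 with hl | hl
  · have norm_le : ∀ v ∈ Ι (1 + |l|)⁻¹ 1, ‖exp (I * l * v) / v‖ ≤ 1 + |l| := fun v hv => by
      rw [uIoc_of_le a_le_one] at hv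
      rw [norm_div, norm_exp_I_mul_mul, Complex.norm_real,
        Real.norm_of_nonneg (a_pos.trans hv.1).le, one_div]
      exact inv_le_of_inv_le₀ (by positivity) hv.1.le
    refine (intervalIntegral.norm_integral_le_of_norm_le_const norm_le).trans ?_
    rw [abs_of_nonneg (sub_nonneg.2 a_le_one)]
    calc (1 + |l|) * (1 - (1 + |l|)⁻¹) = |l| := by field_simp; ring
      _ ≤ 4 := by linarith
  · refine (norm_integral_exp_div_le (abs_pos.1 (by linarith)) a_pos a_le_one).trans ?_
    rw [div_le_iff₀ (by positivity), inv_mul_eq_div, mul_div_assoc', le_div_iff₀ (by positivity)]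
    linarith

theorem norm_phiExponent_add_log_le (l : ℝ) : ‖phiExponent l + log (1 + |l|)‖ ≤ 5 := by
  have abs_l_nonneg := abs_nonneg l
  set a : ℝ := (1 + |l|)⁻¹ with ha
  have a_pos : 0 < a := by positivity
  have a_le_one : a ≤ 1 := inv_le_one_of_one_le₀ (by linarith)
  have ne_zero : ∀ v ∈ [[a, 1]], v ≠ 0 := fun v hv =>
    (a_pos.trans_le (uIcc_of_le a_le_one ▸ hv).1).ne'
  have inv_cont : ContinuousOn (fun v : ℝ => 1 / (v : ℂ)) [[a, 1]] :=
    continuousOn_const.div Complex.continuous_ofReal.continuousOn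
      fun v hv => Complex.ofReal_ne_zero.2 (ne_zero v hv)
  have exp_div_cont : ContinuousOn (fun v : ℝ => exp (I * l * v) / v) [[a, 1]] :=
    ContinuousOn.div (by fun_prop) (by fun_prop) fun v hv =>
      Complex.ofReal_ne_zero.2 (ne_zero v hv)
  have integral_inv : ∫ v in a..1, 1 / (v : ℂ) = log (1 + |l|) := by
    simp only [← Complex.ofReal_one, ← Complex.ofReal_div]
    rw [intervalIntegral.integral_ofReal, integral_one_div_of_pos a_pos one_pos, one_div, ha,
      inv_inv]
  have integral_kernel : ∫ v in a..1, phiKernel l v =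
      (∫ v in a..1, exp (I * l * v) / v) - log (1 + |l|) := by
    rw [← integral_inv, ← intervalIntegral.integral_sub exp_div_cont.intervalIntegrable
      inv_cont.intervalIntegrable]
    simp only [phiKernel, sub_div]
  have decomposition : phiExponent l + log (1 + |l|) =
      (∫ v in 0..a, phiKernel l v) + ∫ v in a..1, exp (I * l * v) / v := by
    rw [phiExponent, ← intervalIntegral.integral_add_adjacent_intervals
      (intervalIntegrable_phiKernel l 0 a) (intervalIntegrable_phiKernel l a 1), integral_kernel]
    ring
  have near_zero : ‖∫ v in 0..a, phiKernel l v‖ ≤ 1 := by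
    refine (norm_integral_phiKernel_le l a).trans ?_
    rw [abs_of_pos a_pos, ha, ← div_eq_mul_inv, div_le_one (by positivity)]
    linarith
  rw [decomposition]
  linarith [norm_add_le_of_le near_zero (norm_integral_exp_div_inv_one_add_abs_le l)]

theorem norm_phi_le (α : ℂ) (l : ℝ) :
    ‖phi α l‖ ≤ Real.exp (5 * ‖α‖) * (1 + |l|) ^ (-α.re) := by
  have one_add_pos : 0 < 1 + |l| := by positivity
  have re_eq : (α * phiExponent l).re =
      (α * (phiExponent l + log (1 + |l|))).re + log (1 + |l|) * -α.re := by
    simp only [mul_add, Complex.add_re, Complex.re_mul_ofReal]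
    ring
  have re_le : (α * (phiExponent l + log (1 + |l|))).re ≤ 5 * ‖α‖ := by
    refine (Complex.re_le_norm _).trans ?_
    rw [norm_mul, mul_comm]
    exact mul_le_mul_of_nonneg_right (norm_phiExponent_add_log_le l) (norm_nonneg α)
  rw [phi_eq_exp, Complex.norm_exp, re_eq, Real.exp_add, Real.rpow_def_of_pos one_add_pos]
  gcongr

/-! ### Comparison of the prime sum with the exponent -/

theorem hasDerivAt_phiKernel (m : ℝ) {t : ℝ} (ht : t ≠ 0) :
    HasDerivAt (phiKernel m)
      ((I * m * t * exp (I * m * t) - (exp (I * m * t) - 1)) / (t : ℂ) ^ 2) t := by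
  refine (((hasDerivAt_exp_I_mul_mul m t).sub_const 1).div (hasDerivAt_id t).ofReal_comp
    (Complex.ofReal_ne_zero.2 ht)).congr_deriv ?_
  simp only [id, Complex.ofReal_one]
  ring

theorem continuousOn_deriv_phiKernel (m : ℝ) : ContinuousOn (deriv (phiKernel m)) {0}ᶜ := by
  refine ContinuousOn.congr (ContinuousOn.div (by fun_prop) (by fun_prop) fun t ht => ?_)
    fun t ht => (hasDerivAt_phiKernel m ht).deriv
  exact pow_ne_zero 2 (Complex.ofReal_ne_zero.2 ht)

theorem norm_mul_exp_sub_exp_sub_one_le {z : ℂ} (hz : ‖exp z‖ = 1) :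
    ‖z * exp z - (exp z - 1)‖ ≤ 6 * ‖z‖ ^ 2 / (1 + ‖z‖) := by
  have hz_nonneg := norm_nonneg z
  rw [le_div_iff₀ (by positivity)]
  rcases le_total ‖z‖ 1 with h | h
  · have : ‖z * exp z - (exp z - 1)‖ ≤ ‖z‖ * (2 * ‖z‖) + ‖z‖ ^ 2 := by
      calc ‖z * exp z - (exp z - 1)‖ = ‖z * (exp z - 1) - (exp z - 1 - z)‖ := by congr 1; ring
        _ ≤ ‖z * (exp z - 1)‖ + ‖exp z - 1 - z‖ := norm_sub_le _ _
        _ ≤ ‖z‖ * (2 * ‖z‖) + ‖z‖ ^ 2 := by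
          rw [norm_mul]
          gcongr
          · exact Complex.norm_exp_sub_one_le h
          · exact Complex.norm_exp_sub_one_sub_id_le h
    refine (mul_le_mul_of_nonneg_right this (by positivity)).trans ?_
    nlinarith [sq_nonneg ‖z‖]
  · have : ‖z * exp z - (exp z - 1)‖ ≤ ‖z‖ + 2 := by
      refine (norm_sub_le _ _).trans (add_le_add (by rw [norm_mul, hz, mul_one]) ?_)
      refine (norm_sub_le _ _).trans ?_
      rw [hz, norm_one]
      norm_num
    refine (mul_le_mul_of_nonneg_right this (by positivity)).trans ?_
    nlinarith

theorem norm_deriv_phiKernel_le (m : ℝ) {t : ℝ} (ht : 0 < t) :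
    ‖deriv (phiKernel m) t‖ ≤ 6 * m ^ 2 / (1 + |m| * t) := by
  have norm_eq : ‖I * m * t‖ = |m| * t := by simp [abs_of_pos ht]
  have bound := norm_mul_exp_sub_exp_sub_one_le (norm_exp_I_mul_mul m t)
  rw [norm_eq] at bound
  rw [(hasDerivAt_phiKernel m ht.ne').deriv, norm_div, norm_pow, Complex.norm_real,
    Real.norm_of_nonneg ht.le, div_le_iff₀ (by positivity)]
  refine bound.trans_eq ?_
  rw [mul_pow, sq_abs]
  ring

theorem integral_norm_deriv_phiKernel_le (m : ℝ) {a b : ℝ} (ha : 0 < a) (hab : a ≤ b) :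
    ∫ t in a..b, ‖deriv (phiKernel m) t‖ ≤ 6 * |m| * log (1 + |m| * b) := by
  have pos : ∀ t ∈ [[a, b]], 0 < t := fun t ht => ha.trans_le (uIcc_of_le hab ▸ ht).1
  have one_add_pos : ∀ t ∈ [[a, b]], 0 < 1 + |m| * t := fun t ht => by
    have := pos t ht
    positivity
  have deriv_int : IntervalIntegrable (fun t => ‖deriv (phiKernel m) t‖) volume a b :=
    ((continuousOn_deriv_phiKernel m).mono fun t ht => (pos t ht).ne').norm.intervalIntegrable
  have bound_int : IntervalIntegrable (fun t => 6 * m ^ 2 / (1 + |m| * t)) volume a b :=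
    (ContinuousOn.div (by fun_prop) (by fun_prop)
      fun t ht => (one_add_pos t ht).ne').intervalIntegrable
  have integral_bound : ∫ t in a..b, 6 * m ^ 2 / (1 + |m| * t) =
      6 * |m| * log (1 + |m| * b) - 6 * |m| * log (1 + |m| * a) := by
    refine intervalIntegral.integral_eq_sub_of_hasDerivAt
      (f := fun t => 6 * |m| * log (1 + |m| * t)) (fun t ht => ?_) bound_int
    refine (((((hasDerivAt_id t).const_mul |m|).const_add 1).log
      (one_add_pos t ht).ne').const_mul (6 * |m|)).congr_deriv ?_
    simp only [id, mul_one]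
    rw [← sq_abs m]
    ring
  calc ∫ t in a..b, ‖deriv (phiKernel m) t‖
      ≤ ∫ t in a..b, 6 * m ^ 2 / (1 + |m| * t) :=
        intervalIntegral.integral_mono_on hab deriv_int bound_int fun t ht =>
          norm_deriv_phiKernel_le m (ha.trans_le ht.1)
    _ = 6 * |m| * log (1 + |m| * b) - 6 * |m| * log (1 + |m| * a) := integral_bound
    _ ≤ 6 * |m| * log (1 + |m| * b) := by
        have : 0 ≤ |m| * a := by positivity
        exact sub_le_self _ (mul_nonneg (by positivity) (Real.log_nonneg (by linarith)))

/-- The sum `∑_{p ≤ N} (e ^ (i l ξ_N(p)) - 1) / p` over the primes, the discrete analogue of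
`phiExponent l` that governs the Euler product for `phiN`. -/
noncomputable def primeExponent (N : ℕ) (l : ℝ) : ℂ :=
  ∑ p ∈ N.primesLE, (exp (I * l * xi N p) - 1) / p

theorem primeExponent_eq_sum_phiKernel (N : ℕ) (l : ℝ) :
    primeExponent N l =
      ∑ p ∈ N.primesLE, phiKernel (l / log N) (log p) * ((log p / p : ℝ) : ℂ) := by
  refine Finset.sum_congr rfl fun p hp => ?_
  have log_p_pos : 0 < log p := Real.log_pos (by exact_mod_cast Nat.one_lt_of_mem_primesLE hp)
  have log_p_ne : (log p : ℂ) ≠ 0 := Complex.ofReal_ne_zero.2 log_p_pos.ne'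
  have angle : I * l * xi N p = I * (l / log N : ℝ) * (log p : ℝ) := by
    simp only [xi, Complex.ofReal_div]
    ring
  rw [phiKernel, angle, Complex.ofReal_div (log p) p, Complex.ofReal_natCast p,
    div_mul_div_cancel₀ log_p_ne]

theorem integral_phiKernel_eq_sub (m a T : ℝ) :
    ∫ t in a..T, phiKernel m t = phiExponent (m * T) - ∫ t in 0..a, phiKernel m t := by
  rw [← integral_phiKernel_zero, intervalIntegral.integral_interval_sub_left
    (intervalIntegrable_phiKernel _ _ _) (intervalIntegrable_phiKernel _ _ _)]

theorem exists_norm_primeExponent_sub_phiExponent_le :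
    ∃ C : ℝ, 0 ≤ C ∧ ∀ N : ℕ, 2 ≤ N → ∀ l : ℝ,
      ‖primeExponent N l - phiExponent l‖ ≤ C * (|l| / log N * (1 + log (1 + |l|))) := by
  obtain ⟨C, hC_nonneg, hC⟩ := exists_norm_sum_comp_log_sub_integral_le ℂ
  refine ⟨6 * C + 1, by positivity, fun N hN l => ?_⟩
  have two_le : (2 : ℝ) ≤ N := by exact_mod_cast hN
  have log_two_pos : 0 < log 2 := Real.log_pos one_lt_two
  have log_two_le_one : log 2 ≤ 1 := by linarith [Real.log_two_lt_d9]
  have log_le : log 2 ≤ log N := Real.log_le_log two_pos two_le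
  have log_pos : 0 < log N := log_two_pos.trans_le log_le
  set m : ℝ := l / log N with hm
  have abs_m : |m| = |l| / log N := by rw [hm, abs_div, abs_of_pos log_pos]
  have ne_zero : ∀ t ∈ Icc (log 2) (log N), t ≠ 0 := fun t ht => (log_two_pos.trans_le ht.1).ne'
  have abel := hC N (phiKernel m) (deriv (phiKernel m)) two_le
    (fun t ht => (hasDerivAt_phiKernel m (ne_zero t ht)).differentiableAt.hasDerivAt)
    ((continuousOn_deriv_phiKernel m).mono ne_zero)
  have variation := integral_norm_deriv_phiKernel_le m log_two_pos log_le
  have initial : ‖∫ t in 0..log 2, phiKernel m t‖ ≤ |m| := by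
    refine (norm_integral_phiKernel_le m _).trans (mul_le_of_le_one_right (abs_nonneg m) ?_)
    rwa [abs_of_pos log_two_pos]
  have sum_eq : ∑ p ∈ ⌊(N : ℝ)⌋₊.primesLE, phiKernel m (log p) * RCLike.ofReal (log p / p) =
      primeExponent N l := by
    rw [Nat.floor_natCast]
    exact (primeExponent_eq_sum_phiKernel N l).symm
  rw [sum_eq, integral_phiKernel_eq_sub, hm, div_mul_cancel₀ l log_pos.ne', ← hm] at abel
  rw [abs_m, div_mul_cancel₀ _ log_pos.ne', ← abs_m] at variation
  have log_nonneg : 0 ≤ log (1 + |l|) := Real.log_nonneg (by linarith [abs_nonneg l])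
  rw [← abs_m]
  calc ‖primeExponent N l - phiExponent l‖
      = ‖(primeExponent N l - (phiExponent l - ∫ t in 0..log 2, phiKernel m t)) -
          ∫ t in 0..log 2, phiKernel m t‖ := by congr 1; ring
    _ ≤ C * (|m| + |m| + 6 * |m| * log (1 + |l|)) + |m| := by
        refine (norm_sub_le _ _).trans (add_le_add (abel.trans ?_) initial)
        gcongr <;> exact norm_phiKernel_le m _
    _ ≤ (6 * C + 1) * (|m| * (1 + log (1 + |l|))) := by
        nlinarith [mul_nonneg hC_nonneg (abs_nonneg m), mul_nonneg (abs_nonneg m) log_nonneg]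

/-! ### The Euler product of `phiN` -/

theorem factorization_prod_primesLE {N : ℕ} (ν : N.primesLE → ℕ) (q : N.primesLE) :
    (∏ p : N.primesLE, (p : ℕ) ^ ν p).factorization q = ν q := by
  have prime (p : N.primesLE) : (p : ℕ).Prime := Nat.prime_of_mem_primesLE p.2
  rw [Nat.factorization_prod_apply fun p _ => pow_ne_zero _ (prime p).ne_zero,
    Finset.sum_eq_single_of_mem q (Finset.mem_univ q), (prime q).factorization_pow,
    Finsupp.single_eq_same]
  intro p _ p_ne_q
  rw [(prime p).factorization_pow,
    Finsupp.single_eq_of_ne fun h => p_ne_q (Subtype.ext h.symm)]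

theorem prod_primesLE_pow_injective (N : ℕ) :
    Function.Injective fun ν : N.primesLE → ℕ => ∏ p : N.primesLE, (p : ℕ) ^ ν p := by
  intro ν ν' h
  funext q
  simpa only [factorization_prod_primesLE] using congrArg (fun n => n.factorization q) h

theorem sum_ensemble_eq_prod {R : Type*} [CommSemiring R] (k N : ℕ) (F : ℕ →* R) :
    ∑ x ∈ ensemble k N, F x = ∏ p ∈ N.primesLE, ∑ j ∈ Finset.range k, F p ^ j := by
  rw [ensemble, Finset.sum_image (prod_primesLE_pow_injective N).injOn, ← Finset.prod_coe_sort,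
    Finset.prod_univ_sum]
  exact Finset.sum_congr rfl fun ν _ => by simp only [map_prod, map_pow]

theorem xi_mul (N : ℕ) {a b : ℕ} (ha : a ≠ 0) (hb : b ≠ 0) :
    xi N (a * b) = xi N a + xi N b := by
  rw [xi, xi, xi, Nat.cast_mul, Real.log_mul (Nat.cast_ne_zero.2 ha) (Nat.cast_ne_zero.2 hb),
    add_div]

/-- The completely multiplicative function `x ↦ α ^ Ω(x) / x · e ^ (i l ξ_N(x))`, whose sum over
the ensemble is `Z · phiN`; it vanishes at `0` because of the division by `x`. -/
noncomputable def twistedWeight (α : ℂ) (N : ℕ) (l : ℝ) : ℕ →* ℂ where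
  toFun x := α ^ ArithmeticFunction.cardFactors x / x * exp (I * l * xi N x)
  map_one' := by simp [xi]
  map_mul' a b := by
    rcases eq_or_ne a 0 with rfl | ha
    · simp
    rcases eq_or_ne b 0 with rfl | hb
    · simp
    rw [ArithmeticFunction.cardFactors_mul ha hb, xi_mul N ha hb, pow_add, Nat.cast_mul,
      Complex.ofReal_add, mul_add, Complex.exp_add]
    ring

theorem twistedWeight_apply (α : ℂ) (N : ℕ) (l : ℝ) (x : ℕ) :
    twistedWeight α N l x =
      α ^ ArithmeticFunction.cardFactors x / x * exp (I * l * xi N x) := rfl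

theorem twistedWeight_apply_prime (α : ℂ) (N : ℕ) (l : ℝ) {p : ℕ} (hp : p.Prime) :
    twistedWeight α N l p = α / p * exp (I * l * xi N p) := by
  rw [twistedWeight_apply, ArithmeticFunction.cardFactors_apply_prime hp, pow_one]

/-- The truncated geometric series `1 + z + ⋯ + z ^ (k - 1)`, the Euler factor of the
partition function. -/
noncomputable def localFactor (k : ℕ) (z : ℂ) : ℂ :=
  ∑ j ∈ Finset.range k, z ^ j

theorem sum_ensemble_twistedWeight (k : ℕ) (α : ℂ) (N : ℕ) (l : ℝ) :
    ∑ x ∈ ensemble k N, twistedWeight α N l x =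
      ∏ p ∈ N.primesLE, localFactor k (α / p * exp (I * l * xi N p)) := by
  rw [sum_ensemble_eq_prod]
  refine Finset.prod_congr rfl fun p hp => ?_
  rw [twistedWeight_apply_prime α N l (Nat.prime_of_mem_primesLE hp), localFactor]

theorem Z_eq_prod (k : ℕ) (α : ℂ) (N : ℕ) :
    Z k α N = ∏ p ∈ N.primesLE, localFactor k (α / p) := by
  simpa only [Z, P, twistedWeight_apply, Complex.ofReal_zero, mul_zero, zero_mul, Complex.exp_zero,
    mul_one] using sum_ensemble_twistedWeight k α N 0

theorem phiN_eq_prod_div (k : ℕ) (α : ℂ) (N : ℕ) (l : ℝ) :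
    phiN k α N l = (∏ p ∈ N.primesLE, localFactor k (α / p * exp (I * l * xi N p))) /
      ∏ p ∈ N.primesLE, localFactor k (α / p) := by
  rw [← sum_ensemble_twistedWeight, ← Z_eq_prod, Finset.sum_div, phiN]
  refine Finset.sum_congr rfl fun x _ => ?_
  rw [PN, P, Finset.sum_singleton, twistedWeight_apply]
  ring

/-- The logarithm of `localFactor k z` (for `‖z‖ < 1`) without its linear term `z`. -/
noncomputable def localLog (k : ℕ) (z : ℂ) : ℂ :=
  Complex.log (1 - z ^ k) - Complex.log (1 - z) - z

theorem one_sub_mem_slitPlane {z : ℂ} (hz : ‖z‖ < 1) : 1 - z ∈ Complex.slitPlane := by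
  rw [sub_eq_add_neg]
  exact Complex.mem_slitPlane_of_norm_lt_one (by rwa [norm_neg])

theorem one_sub_pow_mem_slitPlane {k : ℕ} (hk : k ≠ 0) {z : ℂ} (hz : ‖z‖ < 1) :
    1 - z ^ k ∈ Complex.slitPlane :=
  one_sub_mem_slitPlane <| by
    rw [norm_pow]
    exact pow_lt_one₀ (norm_nonneg z) hz hk

theorem exp_localLog_add {k : ℕ} (hk : k ≠ 0) {z : ℂ} (hz : ‖z‖ < 1) :
    exp (localLog k z + z) = localFactor k z := by
  have one_sub_ne := Complex.slitPlane_ne_zero (one_sub_mem_slitPlane hz)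
  have one_sub_pow_ne := Complex.slitPlane_ne_zero (one_sub_pow_mem_slitPlane hk hz)
  rw [localLog, sub_add_cancel, Complex.exp_sub, Complex.exp_log one_sub_ne,
    Complex.exp_log one_sub_pow_ne, div_eq_iff one_sub_ne, localFactor, geom_sum_mul_neg]

theorem hasDerivAt_localLog {k : ℕ} (hk : k ≠ 0) {z : ℂ} (hz : ‖z‖ < 1) :
    HasDerivAt (localLog k) (z / (1 - z) - k * z ^ (k - 1) / (1 - z ^ k)) z := by
  refine (((((hasDerivAt_pow k z).const_sub 1).clog (one_sub_pow_mem_slitPlane hk hz)).sub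
    (((hasDerivAt_id z).const_sub 1).clog (one_sub_mem_slitPlane hz))).sub
      (hasDerivAt_id z)).congr_deriv ?_
  have one_sub_ne := Complex.slitPlane_ne_zero (one_sub_mem_slitPlane hz)
  simp only [id]
  field_simp
  ring

theorem norm_deriv_localLog_le {k : ℕ} (hk : 2 ≤ k) {z : ℂ} {r : ℝ} (hr : r < 1)
    (hz : ‖z‖ ≤ r) :
    ‖z / (1 - z) - k * z ^ (k - 1) / (1 - z ^ k)‖ ≤ (k + 1) / (1 - r) * ‖z‖ := by
  have : 0 < 1 - r := sub_pos.2 hr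
  have norm_pow_le {j : ℕ} (hj : j ≠ 0) : ‖z ^ j‖ ≤ ‖z‖ := by
    rw [norm_pow]
    exact pow_le_of_le_one (norm_nonneg z) (hz.trans hr.le) hj
  have le_norm_one_sub {w : ℂ} (hw : ‖w‖ ≤ ‖z‖) : 1 - r ≤ ‖1 - w‖ := by
    have := norm_sub_norm_le 1 w
    rw [norm_one] at this
    linarith
  calc ‖z / (1 - z) - k * z ^ (k - 1) / (1 - z ^ k)‖
      ≤ ‖z‖ / ‖1 - z‖ + k * ‖z ^ (k - 1)‖ / ‖1 - z ^ k‖ := by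
        refine (norm_sub_le _ _).trans_eq ?_
        rw [norm_div, norm_div, norm_mul, Complex.norm_natCast]
    _ ≤ ‖z‖ / (1 - r) + k * ‖z‖ / (1 - r) := by
        gcongr
        · exact le_norm_one_sub le_rfl
        · exact norm_pow_le (by lia)
        · exact le_norm_one_sub (norm_pow_le (by lia))
    _ = (k + 1) / (1 - r) * ‖z‖ := by ring

theorem norm_localLog_mul_sub_le {k : ℕ} (hk : 2 ≤ k) {z w : ℂ} {r : ℝ} (hr : r < 1)
    (hz : ‖z‖ ≤ r) (hw : ‖w‖ = 1) :
    ‖localLog k (z * w) - localLog k z‖ ≤ (k + 1) / (1 - r) * ‖z‖ ^ 2 * ‖w - 1‖ := by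
  have : 0 < 1 - r := sub_pos.2 hr
  have norm_le {x : ℂ} (hx : x ∈ Metric.closedBall 0 ‖z‖) : ‖x‖ ≤ ‖z‖ :=
    mem_closedBall_zero_iff.1 hx
  have mean_value := (convex_closedBall (0 : ℂ) ‖z‖).norm_image_sub_le_of_norm_hasDerivWithin_le
    (C := (k + 1) / (1 - r) * ‖z‖) (x := z) (y := z * w)
    (fun x hx => (hasDerivAt_localLog (by lia : k ≠ 0)
      (((norm_le hx).trans hz).trans_lt hr)).hasDerivWithinAt)
    (fun x hx => (norm_deriv_localLog_le hk hr ((norm_le hx).trans hz)).trans <| by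
      gcongr
      exact norm_le hx)
    (by simp) (by simp [hw])
  refine mean_value.trans_eq ?_
  rw [← mul_sub_one, norm_mul]
  ring

/-- The sum over the primes `p ≤ N` of the differences of `localLog` between the Euler factors of
the numerator and of the denominator of `phiN`. -/
noncomputable def phiNRemainder (k : ℕ) (α : ℂ) (N : ℕ) (l : ℝ) : ℂ :=
  ∑ p ∈ N.primesLE, (localLog k (α / p * exp (I * l * xi N p)) - localLog k (α / p))

theorem norm_div_prime_le {N p : ℕ} (hp : p ∈ N.primesLE) (α : ℂ) : ‖α / p‖ ≤ ‖α‖ / 2 := by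
  have two_le : (2 : ℝ) ≤ p := by exact_mod_cast Nat.two_le_of_mem_primesLE hp
  rw [norm_div, Complex.norm_natCast]
  gcongr

theorem phiN_eq_exp {k : ℕ} (hk : k ≠ 0) {α : ℂ} (hα : ‖α‖ < 2) (N : ℕ) (l : ℝ) :
    phiN k α N l = exp (α * primeExponent N l + phiNRemainder k α N l) := by
  have norm_lt_one {p : ℕ} (hp : p ∈ N.primesLE) : ‖α / p‖ < 1 :=
    (norm_div_prime_le hp α).trans_lt (by linarith)
  have denominator : ∏ p ∈ N.primesLE, localFactor k (α / p) =
      ∏ p ∈ N.primesLE, exp (localLog k (α / p) + α / p) :=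
    Finset.prod_congr rfl fun p hp => (exp_localLog_add hk (norm_lt_one hp)).symm
  have numerator : ∏ p ∈ N.primesLE, localFactor k (α / p * exp (I * l * xi N p)) =
      ∏ p ∈ N.primesLE, exp (localLog k (α / p * exp (I * l * xi N p)) +
        α / p * exp (I * l * xi N p)) := by
    refine Finset.prod_congr rfl fun p hp => (exp_localLog_add hk ?_).symm
    rw [norm_mul, norm_exp_I_mul_mul, mul_one]
    exact norm_lt_one hp
  rw [phiN_eq_prod_div, denominator, numerator, ← Complex.exp_sum, ← Complex.exp_sum,
    ← Complex.exp_sub, ← Finset.sum_sub_distrib, primeExponent, Finset.mul_sum, phiNRemainder,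
    ← Finset.sum_add_distrib]
  exact congrArg exp (Finset.sum_congr rfl fun p _ => by ring)

theorem norm_exp_xi_sub_one_le {N p : ℕ} (hp : p ∈ N.primesLE) (l : ℝ) :
    ‖exp (I * l * xi N p) - 1‖ ≤ 4 * min 1 (|l| / log N) * log p := by
  have two_le : (2 : ℝ) ≤ p := by exact_mod_cast Nat.two_le_of_mem_primesLE hp
  have half_le : 1 / 2 ≤ log p := by
    linarith [Real.log_two_gt_d9, Real.log_le_log two_pos two_le]
  have log_N_nonneg : 0 ≤ log N := Real.log_natCast_nonneg N
  rw [mul_min_of_nonneg _ _ (by norm_num), min_mul_of_nonneg _ _ (by linarith), le_min_iff]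
  constructor
  · have := norm_sub_le (exp (I * l * xi N p)) 1
    rw [norm_exp_I_mul_mul, norm_one] at this
    linarith
  · have nonneg : 0 ≤ |l| / log N * log p := by positivity
    calc ‖exp (I * l * xi N p) - 1‖
        ≤ |l| * |xi N p| := norm_exp_I_mul_mul_sub_one_le l (xi N p)
      _ = |l| / log N * log p := by
          rw [xi, abs_of_nonneg (div_nonneg (by linarith) log_N_nonneg)]
          ring
      _ ≤ 4 * (|l| / log N) * log p := by linarith

theorem exists_norm_phiNRemainder_le {k : ℕ} (hk : 2 ≤ k) {α : ℂ} (hα : ‖α‖ < 2) :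
    ∃ C : ℝ, 0 ≤ C ∧ ∀ (N : ℕ) (l : ℝ), ‖phiNRemainder k α N l‖ ≤ C * min 1 (|l| / log N) := by
  have one_sub_pos : 0 < 1 - ‖α‖ / 2 := by linarith
  set K : ℝ := (k + 1) / (1 - ‖α‖ / 2) * ‖α‖ ^ 2 with K_def
  have : 0 ≤ K := by positivity
  refine ⟨4 * K * ∑' n : ℕ, log n / ((n : ℝ) * (n - 1)),
    mul_nonneg (by positivity) (tsum_nonneg log_div_mul_sub_one_nonneg), fun N l => ?_⟩
  set μ : ℝ := min 1 (|l| / log N)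
  have : 0 ≤ μ :=
    le_min zero_le_one (div_nonneg (abs_nonneg l) (Real.log_natCast_nonneg N))
  have term_le (p : ℕ) (hp : p ∈ N.primesLE) :
      ‖localLog k (α / p * exp (I * l * xi N p)) - localLog k (α / p)‖ ≤
        4 * K * μ * (log p / ((p : ℝ) * (p - 1))) := by
    have two_le : (2 : ℝ) ≤ p := by exact_mod_cast Nat.two_le_of_mem_primesLE hp
    have sub_one_pos : 0 < (p : ℝ) - 1 := by linarith
    calc _ ≤ (k + 1) / (1 - ‖α‖ / 2) * ‖α / p‖ ^ 2 * ‖exp (I * l * xi N p) - 1‖ :=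
          norm_localLog_mul_sub_le hk (by linarith) (norm_div_prime_le hp α)
            (norm_exp_I_mul_mul l _)
      _ = K * (1 / (p * p)) * ‖exp (I * l * xi N p) - 1‖ := by
          rw [K_def, norm_div, Complex.norm_natCast]
          ring
      _ ≤ K * (1 / (p * (p - 1))) * (4 * μ * log p) := by
          gcongr
          · linarith
          · exact norm_exp_xi_sub_one_le hp l
      _ = 4 * K * μ * (log p / (p * (p - 1))) := by ring
  calc ‖phiNRemainder k α N l‖
      ≤ ∑ p ∈ N.primesLE, 4 * K * μ * (log p / ((p : ℝ) * (p - 1))) :=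
        norm_sum_le_of_le _ term_le
    _ ≤ 4 * K * μ * ∑' n : ℕ, log n / ((n : ℝ) * (n - 1)) := by
        rw [← Finset.mul_sum]
        gcongr
        exact summable_log_div_mul_sub_one.sum_le_tsum _ fun n _ => log_div_mul_sub_one_nonneg n
    _ = _ := by ring

/-! ### Bounds for `phiN` and for `phiN - phi` -/

theorem continuous_phiN (k : ℕ) (α : ℂ) (N : ℕ) : Continuous (phiN k α N) := by
  unfold phiN
  fun_prop

theorem re_mul_primeExponent_le (α : ℂ) (N : ℕ) (l : ℝ) :
    (α * primeExponent N l).re ≤ (‖α‖ - α.re) * ∑ p ∈ N.primesLE, 1 / (p : ℝ) := by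
  rw [primeExponent, Finset.mul_sum, Finset.mul_sum, Complex.re_sum]
  refine Finset.sum_le_sum fun p _ => ?_
  have re_le : (α * exp (I * l * xi N p)).re ≤ ‖α‖ := by
    simpa only [norm_mul, norm_exp_I_mul_mul, mul_one] using
      Complex.re_le_norm (α * exp (I * l * xi N p))
  rw [← mul_div_assoc, mul_sub_one, Complex.div_natCast_re, Complex.sub_re, mul_one_div]
  gcongr

theorem exists_norm_phiN_le {k : ℕ} (hk : 2 ≤ k) {α : ℂ} (hα : ‖α‖ < 2) :
    ∃ C : ℝ, 0 ≤ C ∧ ∀ N : ℕ, 2 ≤ N → ∀ l : ℝ, ‖phiN k α N l‖ ≤ C * log N ^ (‖α‖ - α.re) := by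
  obtain ⟨C₁, hC₁_nonneg, hC₁⟩ := exists_norm_phiNRemainder_le hk hα
  obtain ⟨C₂, hC₂⟩ := exists_sum_primesLE_inv_le
  have sub_re_nonneg : 0 ≤ ‖α‖ - α.re := sub_nonneg.2 (Complex.re_le_norm α)
  refine ⟨Real.exp ((‖α‖ - α.re) * C₂ + C₁), (Real.exp_pos _).le, fun N hN l => ?_⟩
  have log_N_pos : 0 < log N := Real.log_pos (by exact_mod_cast hN)
  rw [phiN_eq_exp (by lia) hα, Complex.norm_exp, Complex.add_re,
    Real.rpow_def_of_pos log_N_pos, ← Real.exp_add]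
  have remainder_le : (phiNRemainder k α N l).re ≤ C₁ :=
    (Complex.re_le_norm _).trans <| (hC₁ N l).trans <|
      mul_le_of_le_one_right hC₁_nonneg (min_le_left _ _)
  refine Real.exp_le_exp.2 ?_
  linarith [re_mul_primeExponent_le α N l, mul_le_mul_of_nonneg_left (hC₂ N hN) sub_re_nonneg]

theorem norm_exp_sub_one_le_mul_exp (z : ℂ) : ‖exp z - 1‖ ≤ ‖z‖ * Real.exp ‖z‖ := by
  simpa using Complex.norm_exp_sub_sum_le_norm_mul_exp z 1

/-- The difference of the exponents of `phiN` and `phi`. -/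
noncomputable def exponentError (k : ℕ) (α : ℂ) (N : ℕ) (l : ℝ) : ℂ :=
  α * (primeExponent N l - phiExponent l) + phiNRemainder k α N l

theorem phiN_eq_phi_mul_exp {k : ℕ} (hk : k ≠ 0) {α : ℂ} (hα : ‖α‖ < 2) (N : ℕ) (l : ℝ) :
    phiN k α N l = phi α l * exp (exponentError k α N l) := by
  rw [phiN_eq_exp hk hα, phi_eq_exp, ← Complex.exp_add, exponentError]
  ring_nf

theorem exists_norm_exponentError_le {k : ℕ} (hk : 2 ≤ k) {α : ℂ} (hα : ‖α‖ < 2) :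
    ∃ C : ℝ, 0 < C ∧ ∀ N : ℕ, 2 ≤ N → ∀ l : ℝ,
      ‖exponentError k α N l‖ ≤ C * (|l| / log N) * (1 + log (1 + |l|)) := by
  obtain ⟨C₁, hC₁_nonneg, hC₁⟩ := exists_norm_phiNRemainder_le hk hα
  obtain ⟨C₂, hC₂_nonneg, hC₂⟩ := exists_norm_primeExponent_sub_phiExponent_le
  refine ⟨‖α‖ * C₂ + C₁ + 1, by positivity, fun N hN l => ?_⟩
  set q : ℝ := |l| / log N
  have q_nonneg : 0 ≤ q := div_nonneg (abs_nonneg l) (Real.log_natCast_nonneg N)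
  have log_nonneg : 0 ≤ log (1 + |l|) := Real.log_nonneg (by linarith [abs_nonneg l])
  have remainder_le : ‖phiNRemainder k α N l‖ ≤ C₁ * q :=
    (hC₁ N l).trans (mul_le_mul_of_nonneg_left (min_le_right _ _) hC₁_nonneg)
  calc ‖exponentError k α N l‖
      ≤ ‖α‖ * ‖primeExponent N l - phiExponent l‖ + ‖phiNRemainder k α N l‖ := by
        rw [← norm_mul]
        exact norm_add_le _ _
    _ ≤ ‖α‖ * (C₂ * (q * (1 + log (1 + |l|)))) + (C₁ + 1) * (q * (1 + log (1 + |l|))) := by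
        gcongr
        · exact hC₂ N hN l
        · refine remainder_le.trans ?_
          gcongr
          · linarith
          · exact le_mul_of_one_le_right q_nonneg (by linarith)
    _ = (‖α‖ * C₂ + C₁ + 1) * q * (1 + log (1 + |l|)) := by ring

theorem one_add_log_le_mul_rpow {x τ : ℝ} (hx : 1 ≤ x) (hτ : 0 < τ) :
    1 + log x ≤ (1 + 1 / τ) * x ^ τ := by
  have log_le := Real.log_le_rpow_div (zero_le_one.trans hx) hτ
  have one_le := Real.one_le_rpow hx hτ.le
  calc 1 + log x ≤ x ^ τ + x ^ τ / τ := add_le_add one_le log_le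
    _ = (1 + 1 / τ) * x ^ τ := by ring

theorem exists_norm_phiN_sub_phi_le {k : ℕ} (hk : 2 ≤ k) {α : ℂ} (hα : ‖α‖ < 2)
    {τ : ℝ} (hτ : 0 < τ) :
    ∃ C ρ : ℝ, 0 ≤ C ∧ 0 < ρ ∧ ∀ N : ℕ, 2 ≤ N → ∀ l : ℝ, |l| / log N ≤ ρ →
      ‖phiN k α N l - phi α l‖ ≤ C / log N * (1 + |l|) ^ (1 - α.re + 2 * τ) := by
  obtain ⟨K, hK_pos, hK⟩ := exists_norm_exponentError_le hk hα
  refine ⟨Real.exp (5 * ‖α‖) * (K * (1 + 1 / τ) * Real.exp τ), τ / K, by positivity,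
    by positivity, fun N hN l hl => ?_⟩
  have log_N_pos : 0 < log N := Real.log_pos (by exact_mod_cast hN)
  have one_le : 1 ≤ 1 + |l| := by linarith [abs_nonneg l]
  have one_add_pos : 0 < 1 + |l| := by linarith
  have log_nonneg : 0 ≤ log (1 + |l|) := Real.log_nonneg one_le
  have exp_norm_le : Real.exp ‖exponentError k α N l‖ ≤ Real.exp τ * (1 + |l|) ^ τ := by
    rw [Real.rpow_def_of_pos one_add_pos, ← Real.exp_add, Real.exp_le_exp]
    calc ‖exponentError k α N l‖
        ≤ K * (|l| / log N) * (1 + log (1 + |l|)) := hK N hN l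
      _ ≤ τ * (1 + log (1 + |l|)) := by
          gcongr
          rwa [mul_comm, ← le_div_iff₀ hK_pos]
      _ = τ + log (1 + |l|) * τ := by ring
  have norm_error_le : ‖exponentError k α N l‖ ≤
      K * ((1 + |l|) / log N) * ((1 + 1 / τ) * (1 + |l|) ^ τ) := by
    refine (hK N hN l).trans ?_
    gcongr
    · linarith
    · exact one_add_log_le_mul_rpow one_le hτ
  calc ‖phiN k α N l - phi α l‖
      = ‖phi α l‖ * ‖exp (exponentError k α N l) - 1‖ := by
        rw [phiN_eq_phi_mul_exp (by lia) hα, ← mul_sub_one, norm_mul]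
    _ ≤ Real.exp (5 * ‖α‖) * (1 + |l|) ^ (-α.re) *
          (K * ((1 + |l|) / log N) * ((1 + 1 / τ) * (1 + |l|) ^ τ) *
            (Real.exp τ * (1 + |l|) ^ τ)) := by
        refine mul_le_mul (norm_phi_le α l) ((norm_exp_sub_one_le_mul_exp _).trans ?_)
          (norm_nonneg _) (by positivity)
        gcongr
    _ = Real.exp (5 * ‖α‖) * (K * (1 + 1 / τ) * Real.exp τ) / log N *
          (1 + |l|) ^ (1 - α.re + 2 * τ) := by
        rw [show 1 - α.re + 2 * τ = 1 + -α.re + τ + τ by ring, Real.rpow_add one_add_pos,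
          Real.rpow_add one_add_pos, Real.rpow_add one_add_pos, Real.rpow_one]
        ring

/-! ### Integrals of powers of `1 + |l|` -/

theorem setIntegral_comp_abs {A : Set ℝ} (hA : MeasurableSet A) (F : ℝ → ℝ) :
    ∫ l in {l : ℝ | |l| ∈ A}, F |l| = 2 * ∫ x in A ∩ Ioi 0, F x := by
  have meas : MeasurableSet {l : ℝ | |l| ∈ A} := hA.preimage continuous_abs.measurable
  rw [← integral_indicator meas, inter_comm,
    ← setIntegral_indicator hA, ← integral_comp_abs (f := A.indicator F)]
  rfl

theorem setOf_abs_le (R : ℝ) : {l : ℝ | |l| ≤ R} = Icc (-R) R :=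
  ext fun l => abs_le (a := l)

theorem measurableSet_abs_le (R : ℝ) : MeasurableSet {l : ℝ | |l| ≤ R} :=
  setOf_abs_le R ▸ measurableSet_Icc

theorem compl_setOf_abs_le (R : ℝ) : {l : ℝ | |l| ≤ R}ᶜ = {l : ℝ | R < |l|} :=
  ext fun l => not_le (a := |l|)

theorem integrable_one_add_abs_rpow {s : ℝ} (hs : s < -1) :
    Integrable fun l : ℝ => (1 + |l|) ^ s := by
  simpa only [neg_neg, Real.norm_eq_abs] using integrable_one_add_norm (E := ℝ) (μ := volume)
    (r := -s) (by rw [Module.finrank_self, Nat.cast_one]; linarith)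

theorem integrableOn_one_add_abs_rpow (s R : ℝ) :
    IntegrableOn (fun l : ℝ => (1 + |l|) ^ s) {l : ℝ | |l| ≤ R} := by
  rw [setOf_abs_le]
  have cont : Continuous fun l : ℝ => 1 + |l| := by fun_prop
  exact (cont.rpow_const fun l => Or.inl (by positivity)).continuousOn.integrableOn_Icc

theorem setIntegral_abs_le_one_add_abs_rpow {s R : ℝ} (hs : s ≠ -1) (hR : 0 ≤ R) :
    ∫ l in {l : ℝ | |l| ≤ R}, (1 + |l|) ^ s = 2 * (((1 + R) ^ (s + 1) - 1) / (s + 1)) := by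
  have zero_notMem : (0 : ℝ) ∉ [[1 + 0, 1 + R]] := notMem_uIcc_of_lt (by norm_num) (by linarith)
  have inter_eq : Iic R ∩ Ioi 0 = Ioc 0 R := inter_comm _ _
  refine (setIntegral_comp_abs measurableSet_Iic fun x => (1 + x) ^ s).trans ?_
  rw [inter_eq, ← intervalIntegral.integral_of_le hR,
    intervalIntegral.integral_comp_add_left (fun x => x ^ s),
    integral_rpow (Or.inr ⟨hs, zero_notMem⟩), add_zero, Real.one_rpow]

theorem setIntegral_abs_le_one_add_abs_rpow_le {s R : ℝ} (hs : s ≠ -1) (hR : 0 ≤ R) :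
    ∫ l in {l : ℝ | |l| ≤ R}, (1 + |l|) ^ s ≤ 2 / |s + 1| * (1 + (1 + R) ^ (s + 1)) := by
  have rpow_nonneg : 0 ≤ (1 + R) ^ (s + 1) := by positivity
  rw [setIntegral_abs_le_one_add_abs_rpow hs hR]
  calc 2 * (((1 + R) ^ (s + 1) - 1) / (s + 1))
      ≤ 2 * (|(1 + R) ^ (s + 1) - 1| / |s + 1|) := by
        rw [← abs_div]
        gcongr
        exact le_abs_self _
    _ ≤ 2 * ((1 + (1 + R) ^ (s + 1)) / |s + 1|) := by
        gcongr
        rw [abs_le]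
        constructor <;> linarith
    _ = 2 / |s + 1| * (1 + (1 + R) ^ (s + 1)) := by ring

theorem setIntegral_lt_abs_one_add_abs_rpow_le {η R : ℝ} (hη : 1 < η) (hR : 0 < R) :
    ∫ l in {l : ℝ | R < |l|}, (1 + |l|) ^ (-η) ≤ 2 / (η - 1) / R ^ (η - 1) := by
  have neg_lt : -η < -1 := neg_lt_neg hη
  have inter_eq : Ioi R ∩ Ioi 0 = Ioi R := inter_eq_left.2 (Ioi_subset_Ioi hR.le)
  have shifted_integrable : IntegrableOn (fun x : ℝ => (1 + x) ^ (-η)) (Ioi R) := by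
    simpa only [add_comm] using integrableOn_add_rpow_Ioi_of_lt (m := 1) neg_lt (by linarith)
  calc ∫ l in {l : ℝ | R < |l|}, (1 + |l|) ^ (-η)
      = 2 * ∫ x in Ioi R, (1 + x) ^ (-η) := by
        rw [← inter_eq]
        exact setIntegral_comp_abs measurableSet_Ioi fun x => (1 + x) ^ (-η)
    _ ≤ 2 * ∫ x in Ioi R, x ^ (-η) := by
        refine mul_le_mul_of_nonneg_left ?_ two_pos.le
        refine setIntegral_mono_on shifted_integrable (integrableOn_Ioi_rpow_of_lt neg_lt hR)
          measurableSet_Ioi fun x hx => ?_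
        exact Real.rpow_le_rpow_of_nonpos (hR.trans hx) (by linarith) (by linarith)
    _ = 2 / (η - 1) / R ^ (η - 1) := by
        rw [integral_Ioi_rpow_of_lt neg_lt hR, show -η + 1 = -(η - 1) by ring, neg_div_neg_eq,
          Real.rpow_neg hR.le]
        ring

/-! ### The space `S` -/

theorem div_one_add_rpow_le {C η x : ℝ} (hC : 0 ≤ C) (hη : 1 ≤ η) (hx : 0 ≤ x) :
    C / (1 + x ^ η) ≤ C * 2 ^ (η - 1) * (1 + x) ^ (-η) := by
  have power_mean : (1 + x) ^ η ≤ 2 ^ (η - 1) * (1 + x ^ η) := by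
    lift x to NNReal using hx
    have := NNReal.rpow_add_le_mul_rpow_add_rpow 1 x hη
    rw [NNReal.one_rpow] at this
    exact_mod_cast this
  rw [Real.rpow_neg (by positivity), ← div_eq_mul_inv,
    div_le_div_iff₀ (by positivity) (by positivity)]
  calc C * (1 + x) ^ η ≤ C * (2 ^ (η - 1) * (1 + x ^ η)) := by gcongr
    _ = C * 2 ^ (η - 1) * (1 + x ^ η) := by ring

theorem exists_ae_norm_le_of_mem_S {η : ℝ} (hη : 1 ≤ η) {f fhat : ℝ → ℂ} (hf : f ∈ S η)
    (hfhat : HasFourierTransform f fhat) :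
    ∃ D : ℝ, ∀ᵐ l, ‖fhat l‖ ≤ D * (1 + |l|) ^ (-η) := by
  obtain ⟨g, hg, C, hC_pos, hC⟩ := hf
  refine ⟨C * 2 ^ (η - 1), ?_⟩
  filter_upwards [hfhat.ae_eq hg] with l hl
  rw [hl]
  exact (hC l).trans (div_one_add_rpow_le hC_pos.le hη (abs_nonneg l))

theorem nonneg_of_ae_norm_le {η D : ℝ} {g : ℝ → ℂ}
    (hD : ∀ᵐ l, ‖g l‖ ≤ D * (1 + |l|) ^ (-η)) : 0 ≤ D := by
  obtain ⟨l, hl⟩ := hD.exists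
  exact nonneg_of_mul_nonneg_left ((norm_nonneg _).trans hl) (by positivity)

theorem integrable_of_ae_norm_le {η D : ℝ} (hη : 1 < η) {g : ℝ → ℂ}
    (hg : AEStronglyMeasurable g) (hD : ∀ᵐ l, ‖g l‖ ≤ D * (1 + |l|) ^ (-η)) :
    Integrable g :=
  ((integrable_one_add_abs_rpow (by linarith)).const_mul D).mono' hg hD

theorem norm_phiN_le_sum (k : ℕ) (α : ℂ) (N : ℕ) (l : ℝ) :
    ‖phiN k α N l‖ ≤ ∑ x ∈ ensemble k N, ‖PN k α N {x}‖ :=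
  norm_sum_le_of_le _ fun x _ => by rw [norm_mul, norm_exp_I_mul_mul, one_mul]

theorem integrable_phiN_mul (k : ℕ) (α : ℂ) (N : ℕ) {g : ℝ → ℂ} (hg : Integrable g) :
    Integrable fun l : ℝ => phiN k α N l * g l :=
  hg.bdd_mul (continuous_phiN k α N).aestronglyMeasurable
    (ae_of_all _ (norm_phiN_le_sum k α N))

theorem integrableOn_phi_mul (α : ℂ) {g : ℝ → ℂ} (hg : Integrable g) (R : ℝ) :
    IntegrableOn (fun l : ℝ => phi α l * g l) {l : ℝ | |l| ≤ R} := by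
  rw [setOf_abs_le]
  exact hg.integrableOn.continuousOn_mul (continuous_phi α).continuousOn isCompact_Icc

/-! ### The error term -/

theorem exists_norm_setIntegral_phiN_mul_le {k : ℕ} (hk : 2 ≤ k) {α : ℂ} (hα : ‖α‖ < 2)
    {η D : ℝ} (hη : 1 < η) {g : ℝ → ℂ} (hD : ∀ᵐ l, ‖g l‖ ≤ D * (1 + |l|) ^ (-η)) :
    ∃ C : ℝ, 0 ≤ C ∧ ∀ N : ℕ, 2 ≤ N → ∀ R : ℝ, 0 < R →
      ‖∫ l in {l : ℝ | R < |l|}, phiN k α N l * g l‖ ≤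
        C * (log N ^ (‖α‖ - α.re) / R ^ (η - 1)) := by
  obtain ⟨C, C_nonneg, phiN_le⟩ := exists_norm_phiN_le hk hα
  have D_nonneg : 0 ≤ D := nonneg_of_ae_norm_le hD
  have : 0 < η - 1 := sub_pos.2 hη
  refine ⟨C * D * (2 / (η - 1)), by positivity, fun N hN R hR => ?_⟩
  have pointwise : ∀ᵐ l, ‖phiN k α N l * g l‖ ≤
      C * log N ^ (‖α‖ - α.re) * D * (1 + |l|) ^ (-η) := by
    filter_upwards [hD] with l hl
    rw [norm_mul, mul_assoc _ D]
    exact mul_le_mul (phiN_le N hN l) hl (norm_nonneg _)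
      ((norm_nonneg _).trans (phiN_le N hN l))
  calc ‖∫ l in {l : ℝ | R < |l|}, phiN k α N l * g l‖
      ≤ ∫ l in {l : ℝ | R < |l|}, C * log N ^ (‖α‖ - α.re) * D * (1 + |l|) ^ (-η) :=
        norm_integral_le_of_norm_le
          ((integrable_one_add_abs_rpow (by linarith)).const_mul _).integrableOn
          (ae_restrict_of_ae pointwise)
    _ ≤ C * log N ^ (‖α‖ - α.re) * D * (2 / (η - 1) / R ^ (η - 1)) := by
        rw [integral_const_mul]
        gcongr
        exact setIntegral_lt_abs_one_add_abs_rpow_le hη hR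
    _ = C * D * (2 / (η - 1)) * (log N ^ (‖α‖ - α.re) / R ^ (η - 1)) := by ring

theorem exists_norm_setIntegral_phiN_sub_phi_mul_le_mul_setIntegral {k : ℕ} (hk : 2 ≤ k) {α : ℂ}
    (hα : ‖α‖ < 2) {η D τ : ℝ} (hτ : 0 < τ) {g : ℝ → ℂ}
    (hD : ∀ᵐ l, ‖g l‖ ≤ D * (1 + |l|) ^ (-η)) :
    ∃ C ρ : ℝ, 0 ≤ C ∧ 0 < ρ ∧ ∀ N : ℕ, 2 ≤ N → ∀ R : ℝ, R / log N ≤ ρ →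
      ‖∫ l in {l : ℝ | |l| ≤ R}, (phiN k α N l - phi α l) * g l‖ ≤
        C / log N * ∫ l in {l : ℝ | |l| ≤ R}, (1 + |l|) ^ (1 - α.re + 2 * τ - η) := by
  obtain ⟨C, ρ, C_nonneg, ρ_pos, diff_le⟩ := exists_norm_phiN_sub_phi_le hk hα hτ
  refine ⟨C * D, ρ, mul_nonneg C_nonneg (nonneg_of_ae_norm_le hD), ρ_pos, fun N hN R hR => ?_⟩
  rw [← integral_const_mul]
  refine norm_integral_le_of_norm_le ((integrableOn_one_add_abs_rpow _ R).const_mul _) ?_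
  filter_upwards [ae_restrict_of_ae hD, ae_restrict_mem (measurableSet_abs_le R)] with l hl hlR
  have base_pos : 0 < 1 + |l| := by positivity
  have diff_le_l := diff_le N hN l
    ((div_le_div_of_nonneg_right hlR (Real.log_natCast_nonneg N)).trans hR)
  calc ‖(phiN k α N l - phi α l) * g l‖
      ≤ C / log N * (1 + |l|) ^ (1 - α.re + 2 * τ) * (D * (1 + |l|) ^ (-η)) := by
        rw [norm_mul]
        exact mul_le_mul diff_le_l hl (norm_nonneg _) ((norm_nonneg _).trans diff_le_l)
    _ = C * D / log N * (1 + |l|) ^ (1 - α.re + 2 * τ - η) := by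
        rw [sub_eq_add_neg _ η, Real.rpow_add base_pos (1 - α.re + 2 * τ)]
        ring

theorem one_add_rpow_sub_div_le {a b c L R ρ : ℝ} (ha : a ≤ 1 + c) (hb : 0 ≤ b) (hc : 0 ≤ c)
    (hL : 1 / 2 ≤ L) (hR : 0 < R) (hRL : R ≤ ρ * L) :
    (1 + R) ^ (a - b) / L ≤ (ρ + 2) ^ (1 + c) * (L ^ c / R ^ b) := by
  have L_pos : 0 < L := by linarith
  have ρ_pos : 0 < ρ := pos_of_mul_pos_left (hR.trans_le hRL) L_pos.le
  calc (1 + R) ^ (a - b) / L = (1 + R) ^ a / (1 + R) ^ b / L := by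
        rw [Real.rpow_sub (by linarith)]
    _ ≤ (1 + R) ^ (1 + c) / R ^ b / L := by
        gcongr <;> linarith
    _ ≤ ((ρ + 2) * L) ^ (1 + c) / R ^ b / L := by
        gcongr
        linarith
    _ = (ρ + 2) ^ (1 + c) * (L ^ c / R ^ b) := by
        rw [Real.mul_rpow (by linarith) L_pos.le, Real.rpow_one_add' L_pos.le (by linarith)]
        field_simp

theorem setIntegral_one_add_abs_rpow_div_le {a c η L R ρ : ℝ} (ha : a ≤ 1 + c) (hc : 0 ≤ c)
    (hη : 1 ≤ η) (hs : a - η ≠ -1) (hL : 1 / 2 ≤ L) (hR : 0 < R) (hRL : R ≤ ρ * L) :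
    (∫ l in {l : ℝ | |l| ≤ R}, (1 + |l|) ^ (a - η)) / L ≤
      2 / |a - η + 1| * (1 + (ρ + 2) ^ (1 + c)) * (1 / L + L ^ c / R ^ (η - 1)) := by
  have L_pos : 0 < L := by linarith
  have ρ_pos : 0 < ρ := pos_of_mul_pos_left (hR.trans_le hRL) L_pos.le
  have inv_nonneg : 0 ≤ 1 / L := by positivity
  have ratio_nonneg : 0 ≤ L ^ c / R ^ (η - 1) := by positivity
  have factor_nonneg : 0 ≤ (ρ + 2) ^ (1 + c) := by positivity
  have scale : (1 + R) ^ (a - η + 1) / L ≤ (ρ + 2) ^ (1 + c) * (L ^ c / R ^ (η - 1)) := by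
    rw [sub_add]
    exact one_add_rpow_sub_div_le ha (sub_nonneg.2 hη) hc hL hR hRL
  calc (∫ l in {l : ℝ | |l| ≤ R}, (1 + |l|) ^ (a - η)) / L
      ≤ 2 / |a - η + 1| * (1 + (1 + R) ^ (a - η + 1)) / L := by
        gcongr
        exact setIntegral_abs_le_one_add_abs_rpow_le hs hR.le
    _ = 2 / |a - η + 1| * (1 / L + (1 + R) ^ (a - η + 1) / L) := by ring
    _ ≤ 2 / |a - η + 1| * ((1 + (ρ + 2) ^ (1 + c)) * (1 / L + L ^ c / R ^ (η - 1))) := by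
        gcongr
        linarith [mul_nonneg factor_nonneg inv_nonneg]
    _ = _ := (mul_assoc _ _ _).symm

theorem phiN_zero {k : ℕ} (hk : k ≠ 0) (N : ℕ) (l : ℝ) : phiN k 0 N l = 1 := by
  rw [phiN_eq_exp hk (by simp)]
  simp [phiNRemainder]

theorem phi_zero (l : ℝ) : phi 0 l = 1 := by
  rw [phi_eq_exp, zero_mul, Complex.exp_zero]

theorem one_half_le_log_natCast {N : ℕ} (hN : 2 ≤ N) : 1 / 2 ≤ log N :=
  calc (1 : ℝ) / 2 ≤ log 2 := by linarith [Real.log_two_gt_d9]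
    _ ≤ log N := Real.log_le_log two_pos (by exact_mod_cast hN)

theorem exists_norm_setIntegral_phiN_sub_phi_mul_le {k : ℕ} (hk : 2 ≤ k) {α : ℂ}
    (hα : ‖α‖ < 2) {η D : ℝ} (hη : 1 ≤ η) {g : ℝ → ℂ}
    (hD : ∀ᵐ l, ‖g l‖ ≤ D * (1 + |l|) ^ (-η)) :
    ∃ C ρ : ℝ, 0 < ρ ∧ ∀ N : ℕ, 2 ≤ N → ∀ R : ℝ, 0 < R → R / log N ≤ ρ →
      ‖∫ l in {l : ℝ | |l| ≤ R}, (phiN k α N l - phi α l) * g l‖ ≤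
        C * (1 / log N + log N ^ (‖α‖ - α.re) / R ^ (η - 1)) := by
  rcases eq_or_ne α 0 with rfl | α_ne_zero
  · refine ⟨0, 1, one_pos, fun N _ R _ _ => ?_⟩
    simp only [phiN_zero (by omega : k ≠ 0), phi_zero, sub_self, zero_mul, integral_zero,
      norm_zero, le_refl]
  have norm_pos : 0 < ‖α‖ := norm_pos_iff.2 α_ne_zero
  -- Avoiding the exponent `-1` keeps the integral over the centre free of a logarithm.
  obtain ⟨τ, τ_pos, τ_le, s_ne⟩ :
      ∃ τ : ℝ, 0 < τ ∧ 2 * τ ≤ ‖α‖ ∧ 1 - α.re + 2 * τ - η ≠ -1 := by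
    by_cases h : 1 - α.re + 2 * (‖α‖ / 2) - η = -1
    · exact ⟨‖α‖ / 4, by positivity, by linarith, by linarith⟩
    · exact ⟨‖α‖ / 2, by positivity, by linarith, h⟩
  obtain ⟨C, ρ, C_nonneg, ρ_pos, center_le⟩ :=
    exists_norm_setIntegral_phiN_sub_phi_mul_le_mul_setIntegral hk hα τ_pos hD
  refine ⟨C * (2 / |1 - α.re + 2 * τ - η + 1| * (1 + (ρ + 2) ^ (1 + (‖α‖ - α.re)))), ρ,
    ρ_pos, fun N hN R hR hRρ => (center_le N hN R hRρ).trans ?_⟩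
  have L_ge : 1 / 2 ≤ log N := one_half_le_log_natCast hN
  have L_pos : 0 < log N := by linarith
  rw [div_mul_eq_mul_div, mul_div_assoc, mul_assoc]
  exact mul_le_mul_of_nonneg_left
    (setIntegral_one_add_abs_rpow_div_le (by linarith) (sub_nonneg.2 (Complex.re_le_norm α)) hη
      s_ne L_ge hR ((div_le_iff₀ L_pos).1 hRρ)) C_nonneg

theorem exists_norm_integral_phiN_mul_sub_setIntegral_phi_mul_le {k : ℕ} (hk : 2 ≤ k) {α : ℂ}
    (hα : ‖α‖ < 2) {η D : ℝ} (hη : 1 < η) {g : ℝ → ℂ} (hg : AEStronglyMeasurable g)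
    (hD : ∀ᵐ l, ‖g l‖ ≤ D * (1 + |l|) ^ (-η)) :
    ∃ C ρ : ℝ, 0 < ρ ∧ ∀ N : ℕ, 2 ≤ N → ∀ R : ℝ, 0 < R → R / log N ≤ ρ →
      ‖(∫ l, phiN k α N l * g l) - ∫ l in {l : ℝ | |l| ≤ R}, phi α l * g l‖ ≤
        C * (1 / log N + log N ^ (‖α‖ - α.re) / R ^ (η - 1)) := by
  have g_int : Integrable g := integrable_of_ae_norm_le hη hg hD
  obtain ⟨C₁, ρ, ρ_pos, center_le⟩ :=
    exists_norm_setIntegral_phiN_sub_phi_mul_le hk hα hη.le hD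
  obtain ⟨C₂, C₂_nonneg, tail_le⟩ := exists_norm_setIntegral_phiN_mul_le hk hα hη hD
  refine ⟨C₁ + C₂, ρ, ρ_pos, fun N hN R hR hRρ => ?_⟩
  have prod_int := integrable_phiN_mul k α N g_int
  have center_add_tail :
      (∫ l, phiN k α N l * g l) - ∫ l in {l : ℝ | |l| ≤ R}, phi α l * g l =
        (∫ l in {l : ℝ | |l| ≤ R}, (phiN k α N l - phi α l) * g l) +
          ∫ l in {l : ℝ | R < |l|}, phiN k α N l * g l := by
    simp only [sub_mul]
    rw [integral_sub prod_int.integrableOn (integrableOn_phi_mul α g_int R),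
      ← integral_add_compl (measurableSet_abs_le R) prod_int, compl_setOf_abs_le]
    ring
  have inv_nonneg : 0 ≤ 1 / log N := one_div_nonneg.2 (Real.log_natCast_nonneg N)
  rw [center_add_tail, add_mul]
  refine (norm_add_le _ _).trans (add_le_add (center_le N hN R hR hRρ) ?_)
  exact (tail_le N hN R hR).trans
    (mul_le_mul_of_nonneg_left (le_add_of_nonneg_left inv_nonneg) C₂_nonneg)

theorem exists_eq_add_of_isBigO_norm_add_norm {ι E F G : Type*} [SeminormedAddCommGroup E]
    [SeminormedAddCommGroup F] [SeminormedAddCommGroup G] {l : Filter ι} {f : ι → E} {u : ι → F}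
    {v : ι → G} (h : f =O[l] fun i => ‖u i‖ + ‖v i‖) :
    ∃ f₁ f₂ : ι → E, (∀ i, f i = f₁ i + f₂ i) ∧ f₁ =O[l] u ∧ f₂ =O[l] v := by
  set s : Set ι := {i | ‖v i‖ ≤ ‖u i‖}
  have indicator_isBigO {t : Set ι} {w : ι → ℝ} (w_nonneg : ∀ i, 0 ≤ w i)
      (add_le : ∀ i ∈ t, ‖u i‖ + ‖v i‖ ≤ 2 * w i) : t.indicator f =O[l] w := by
    obtain ⟨C, C_nonneg, f_isBigOWith⟩ := h.exists_nonneg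
    refine .of_bound (C * 2) ?_
    filter_upwards [f_isBigOWith.bound] with i f_le
    rw [Real.norm_of_nonneg (by positivity)] at f_le
    rw [Real.norm_of_nonneg (w_nonneg i), mul_assoc]
    by_cases hi : i ∈ t
    · rw [indicator_of_mem hi]
      exact f_le.trans (mul_le_mul_of_nonneg_left (add_le i hi) C_nonneg)
    · rw [indicator_of_notMem hi, norm_zero]
      exact mul_nonneg C_nonneg (mul_nonneg two_pos.le (w_nonneg i))
  refine ⟨s.indicator f, sᶜ.indicator f,
    fun i => (congrFun (indicator_self_add_compl s f) i).symm, .of_norm_right ?_, .of_norm_right ?_⟩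
  · refine indicator_isBigO (fun i => norm_nonneg _) fun i (hi : ‖v i‖ ≤ ‖u i‖) => ?_
    linarith
  · refine indicator_isBigO (fun i => norm_nonneg _) fun i (hi : ¬ ‖v i‖ ≤ ‖u i‖) => ?_
    linarith

theorem tendsto_log_natCast_atTop : Tendsto (fun N : ℕ => log N) atTop atTop :=
  Real.tendsto_log_atTop.comp tendsto_natCast_atTop_atTop

theorem tendsto_one_div_log_natCast : Tendsto (fun N : ℕ => 1 / log N) atTop (𝓝 0) :=
  tendsto_const_nhds.div_atTop tendsto_log_natCast_atTop

theorem one_div_log_natCast_isBigO :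
    (fun N : ℕ => 1 / log N) =O[atTop] fun N : ℕ => log (log N) / log N := by
  have one_isBigO : (fun _ : ℕ => (1 : ℝ)) =O[atTop] fun N : ℕ => log (log N) :=
    Real.isLittleO_const_log_atTop.isBigO.comp_tendsto tendsto_log_natCast_atTop
  simpa only [div_eq_mul_inv] using one_isBigO.mul (isBigO_refl (fun N : ℕ => (log N)⁻¹) atTop)

theorem one_lt_of_tendsto_log_rpow_div_rpow {c η : ℝ} (hc : 0 ≤ c) (hη : 1 ≤ η) {R : ℕ → ℝ}
    (hR : Tendsto (fun N : ℕ => log N ^ c / R N ^ (η - 1)) atTop (𝓝 0)) : 1 < η := by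
  refine hη.lt_of_ne' ?_
  rintro rfl
  simp only [sub_self, Real.rpow_zero, div_one] at hR
  obtain ⟨N, lt_one, one_le⟩ := ((hR.eventually_lt_const one_pos).and
    (tendsto_log_natCast_atTop.eventually_ge_atTop 1)).exists
  exact lt_one.not_ge (Real.one_le_rpow one_le hc)

end SmoothSums

theorem mainTheorem3_general {k : ℕ} (hk : 2 ≤ k) {α : ℂ} (hα : ‖α‖ < 2) {η D : ℝ} (hη : 1 ≤ η)
    {g : ℝ → ℂ} (hg : AEStronglyMeasurable g) (hD : ∀ᵐ l, ‖g l‖ ≤ D * (1 + |l|) ^ (-η))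
    {R : ℕ → ℝ} (hRpos : ∀ᶠ N in atTop, 0 < R N)
    (hR : Tendsto (fun N : ℕ => R N / Real.log N) atTop (𝓝 0))
    (hR' : Tendsto (fun N : ℕ => Real.log N ^ (‖α‖ - α.re) / R N ^ (η - 1)) atTop (𝓝 0)) :
    (∀ N : ℕ, Integrable fun l : ℝ => SmoothSums.phiN k α N l * g l) ∧
    (∀ N : ℕ, IntegrableOn (fun l : ℝ => SmoothSums.phi α l * g l) {l : ℝ | |l| ≤ R N}) ∧
    ∃ ε : ℕ → ℂ,
      (∀ N : ℕ, ∫ l : ℝ, SmoothSums.phiN k α N l * g l =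
        (∫ l in {l : ℝ | |l| ≤ R N}, SmoothSums.phi α l * g l) + ε N) ∧
      Tendsto ε atTop (𝓝 0) ∧
      ∃ E₁ E₂ : ℕ → ℂ, (∀ N : ℕ, ε N = E₁ N + E₂ N) ∧
        E₁ =O[atTop] (fun N : ℕ => 1 / Real.log N) ∧
        E₂ =O[atTop] (fun N : ℕ => Real.log N ^ (‖α‖ - α.re) / R N ^ (η - 1)) := by
  have one_lt_η : 1 < η := SmoothSums.one_lt_of_tendsto_log_rpow_div_rpow
    (sub_nonneg.2 (Complex.re_le_norm α)) hη hR'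
  have g_int : Integrable g := SmoothSums.integrable_of_ae_norm_le one_lt_η hg hD
  obtain ⟨C, ρ, ρ_pos, error_le⟩ :=
    SmoothSums.exists_norm_integral_phiN_mul_sub_setIntegral_phi_mul_le hk hα one_lt_η hg hD
  set ε : ℕ → ℂ := fun N => (∫ l : ℝ, SmoothSums.phiN k α N l * g l) -
    ∫ l in {l : ℝ | |l| ≤ R N}, SmoothSums.phi α l * g l
  have ε_isBigO : ε =O[atTop] fun N : ℕ =>
      ‖1 / Real.log N‖ + ‖Real.log N ^ (‖α‖ - α.re) / R N ^ (η - 1)‖ := by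
    refine .of_bound C ?_
    filter_upwards [eventually_ge_atTop 2, hRpos, hR.eventually_le_const ρ_pos] with N hN hR₀ hRρ
    have := Real.log_natCast_nonneg N
    rw [Real.norm_of_nonneg (by positivity), Real.norm_of_nonneg (by positivity),
      Real.norm_of_nonneg (by positivity)]
    exact error_le N hN (R N) hR₀ hRρ
  obtain ⟨E₁, E₂, ε_eq, hE₁, hE₂⟩ := SmoothSums.exists_eq_add_of_isBigO_norm_add_norm ε_isBigO
  refine ⟨fun N => SmoothSums.integrable_phiN_mul k α N g_int,
    fun N => SmoothSums.integrableOn_phi_mul α g_int (R N), ε,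
    fun N => (add_sub_cancel _ _).symm, ε_isBigO.trans_tendsto ?_, E₁, E₂, ε_eq, hE₁, hE₂⟩
  simpa only [norm_zero, add_zero] using
    SmoothSums.tendsto_one_div_log_natCast.norm.add hR'.norm

theorem mainTheorem3 (k : ℕ) (hk : 2 ≤ k) (α : ℂ) (hα : ‖α‖ < 2)
    (η : ℝ) (hη : ‖α‖ - α.re + 1 ≤ η)
    (f : ℝ → ℂ) (hf : f ∈ SmoothSums.S η)
    (fhat : ℝ → ℂ) (hfhat : SmoothSums.HasFourierTransform f fhat)
    (R : ℕ → ℝ) (hRpos : ∀ᶠ N in atTop, 0 < R N)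
    (hR : Tendsto (fun N : ℕ => R N / Real.log N) atTop (𝓝 0))
    (hR' : Tendsto (fun N : ℕ => Real.log N ^ (‖α‖ - α.re) / R N ^ (η - 1)) atTop (𝓝 0)) :
    (∀ N : ℕ, 2 ≤ N → Integrable fun l : ℝ => SmoothSums.phiN k α N l * fhat l) ∧
    (∀ N : ℕ, 2 ≤ N →
      IntegrableOn (fun l : ℝ => SmoothSums.phi α l * fhat l) {l : ℝ | |l| ≤ R N}) ∧
    ∃ ε : ℕ → ℂ,
      (∀ N : ℕ, 2 ≤ N →
        ∫ l : ℝ, SmoothSums.phiN k α N l * fhat l =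
          (∫ l in {l : ℝ | |l| ≤ R N}, SmoothSums.phi α l * fhat l) + ε N) ∧
      Tendsto ε atTop (𝓝 0) ∧
      ∃ E₁ E₂ : ℕ → ℂ, (∀ N : ℕ, ε N = E₁ N + E₂ N) ∧
        E₁ =O[atTop] (fun N : ℕ => Real.log (Real.log N) / Real.log N) ∧
        E₂ =O[atTop] (fun N : ℕ => Real.log N ^ (‖α‖ - α.re) / R N ^ (η - 1)) := by
  obtain ⟨D, hD⟩ := SmoothSums.exists_ae_norm_le_of_mem_S
    (by linarith [Complex.re_le_norm α]) hf hfhat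
  obtain ⟨phiN_int, phi_int, ε, integral_eq, ε_tendsto, E₁, E₂, ε_eq, hE₁, hE₂⟩ :=
    mainTheorem3_general hk hα (by linarith [Complex.re_le_norm α])
      hfhat.locallyIntegrable.aestronglyMeasurable hD hRpos hR hR'
  exact ⟨fun N _ => phiN_int N, fun N _ => phi_int N, ε, fun N _ => integral_eq N, ε_tendsto,
    E₁, E₂, ε_eq, hE₁.trans SmoothSums.one_div_log_natCast_isBigO, hE₂⟩
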